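/- Let $\mathbb D=\{z\in\mathbb C:|z|<1\}$, let $dA=\pi^{-1}dx\,dy$ be normalized area measure on $\mathbb D$, and let $\mathcal H$ be the space of analytic functions on $\mathbb D$ with the topology of uniform convergence on compact sets. A radial weight is a non-negative $dA$-integrable function $\omega$ on $\mathbb D$ with $\omega(z)=\omega(|z|)$ such that $\widehat\omega(r)=\int_r^1\omega(s)\,ds$ is non-zero for $0\le r<1$. It belongs to the class $\mathcal D$ of two-sided doubling weights if there are constants $C>0$, $K>1$ and $C'>1$ such that, for all $0\le r<1$, $$\widehat\omega(r)\le C\,\widehat\omega\Big(\frac{1+r}2\Big)<\infty\qquad\text{and}\qquad \widehat\omega(r)\ge C'\,\widehat\omega\Big(1-\frac{1-r}{K}\Big).$$ Let $A^2_\omega$ be the space of $f\in\mathcal H$ with $\int_{\mathbb D}|f|^2\omega\,dA<\infty$. The Bergman kernel $B^\omega_z\in A^2_\omega$ is determined by $f(z)=\int_{\mathbb D}f(\xi)\overline{B^\omega_z(\xi)}\,\omega(\xi)\,dA(\xi)$ for all $f\in A^2_\omega$, and the Bergman projection is $$P_\omega f(z)=\int_{\mathbb D}f(\xi)\overline{B^\omega_z(\xi)}\,\omega(\xi)\,dA(\xi),\qquad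 z\in\mathbb D.$$ For $\alpha>0$ put $\omega_\alpha(z)=(1-|z|)^\alpha\omega(z)$, and let $R^{\omega,\omega_\alpha}:\mathcal H\to\mathcal H$ be the unique continuous linear operator that satisfies $R^{\omega,\omega_\alpha}B^\omega_z=B^{\omega_\alpha}_z$ for all $z\in\mathbb D$ and commutes with the dilatations $f\mapsto f_r$, $f_r(z)=f(rz)$, $0<r<1$. The Bloch space $\mathcal B$ consists of the $f\in\mathcal H$ with $\|f\|_{\mathcal B}=\sup_{z\in\mathbb D}(1-|z|^2)|f'(z)|+|f(0)|<\infty$. **Theorem.** Let $\omega\in\mathcal D$. Then the integral defining $P_\omega\Phi(z)$ converges absolutely for all $\Phi\in L^\infty(\mathbb D,dA)$ and $z\in\mathbb D$, and $P_\omega$ is a linear operator from $L^\infty(\mathbb D,dA)$ onto $\mathcal B$ that is bounded: there is a constant $C$ with $\|P_\omega\Phi\|_{\mathcal B}\le C\|\Phi\|_\infty$ for all $\Phi\in L^\infty(\mathbb D,dA)$. Moreover, for every $\alpha>0$ and every $h\in\mathcal B$, the function $$g_\alpha(z)=(1-|z|)^\alpha R^{\omega,\omega_\alpha}h(z)$$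 belongs to $L^\infty(\mathbb D,dA)$ and $P_\omega g_\alpha=h$. -/

import Mathlib

open MeasureTheory Set
open scoped ENNReal ComplexConjugate

noncomputable section

namespace BergmanBloch

/-- The open unit disk `𝔻 = {|z| < 1}` as a type. -/
abbrev Disk : Type := ↥(Metric.ball (0 : ℂ) 1)

/-- The centre of the disk. -/
def origin : Disk := ⟨0, Metric.mem_ball_self one_pos⟩

/-- The normalized area measure `dA = π⁻¹ dx dy` on the disk. -/
def dA : Measure Disk :=
  ENNReal.ofReal Real.pi⁻¹ • Measure.comap (Subtype.val : Disk → ℂ) volume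

/-- Extension by zero of a function on the disk to the complex plane. -/
def extend (f : Disk → ℂ) (z : ℂ) : ℂ :=
  open Classical in if h : z ∈ Metric.ball (0 : ℂ) 1 then f ⟨z, h⟩ else 0

theorem extend_coe (f : Disk → ℂ) (z : Disk) : extend f (z : ℂ) = f z := by
  simp only [extend, dif_pos z.2]

theorem extend_of_mem (f : Disk → ℂ) {z : ℂ} (h : z ∈ Metric.ball (0 : ℂ) 1) :
    extend f z = f ⟨z, h⟩ := by
  simp only [extend, dif_pos h]

/-- The space `𝓗` of analytic functions on the disk. As a subspace of `C(𝔻, ℂ)` with the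
compact-open topology it carries the topology of uniform convergence on compact sets. -/
def Hol : Submodule ℂ C(Disk, ℂ) where
  carrier := {f | DifferentiableOn ℂ (extend f) (Metric.ball (0 : ℂ) 1)}
  add_mem' := by
    intro f g hf hg
    refine (DifferentiableOn.add hf hg).congr fun z hz => ?_
    simp [extend_of_mem _ hz]
  zero_mem' := by
    refine (differentiableOn_const (0 : ℂ)).congr fun z hz => ?_
    simp [extend_of_mem _ hz]
  smul_mem' := by
    intro c f hf
    refine (DifferentiableOn.const_smul hf c).congr fun z hz => ?_
    simp [extend_of_mem _ hz]

instance : CoeFun Hol fun _ => Disk → ℂ := ⟨fun f => f.1⟩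

/-- The complex derivative of a function on the disk. -/
def derivative (f : Disk → ℂ) (z : Disk) : ℂ := deriv (extend f) (z : ℂ)

/-- The point `r z` of the disk, for `0 < r < 1`. -/
def scale (r : Ioo (0 : ℝ) 1) (z : Disk) : Disk :=
  ⟨((r : ℝ) : ℂ) * (z : ℂ), by
    have hz : ‖(z : ℂ)‖ < 1 := mem_ball_zero_iff.1 z.2
    rw [mem_ball_zero_iff, norm_mul, Complex.norm_real, Real.norm_of_nonneg r.2.1.le]
    exact mul_lt_one_of_nonneg_of_lt_one_left r.2.1.le r.2.2 hz.le⟩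

theorem continuous_scale (r : Ioo (0 : ℝ) 1) : Continuous (scale r) := by
  unfold scale
  fun_prop

/-- The dilatation `f_r(z) = f(r z)` of an analytic function, `0 < r < 1`. -/
def dilate (r : Ioo (0 : ℝ) 1) (f : Hol) : Hol :=
  ⟨⟨fun z => f (scale r z), f.1.continuous.comp (continuous_scale r)⟩, by
    have hmaps : MapsTo (fun z : ℂ => ((r : ℝ) : ℂ) * z) (Metric.ball (0 : ℂ) 1)
        (Metric.ball (0 : ℂ) 1) := fun z hz => (scale r ⟨z, hz⟩).2
    have hd : DifferentiableOn ℂ (extend f) (Metric.ball (0 : ℂ) 1) := f.2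
    have hm : DifferentiableOn ℂ (fun z : ℂ => ((r : ℝ) : ℂ) * z) (Metric.ball (0 : ℂ) 1) :=
      (differentiable_id.const_mul _).differentiableOn
    refine (hd.comp hm hmaps).congr fun z hz => ?_
    rw [extend_of_mem _ hz, Function.comp_apply, extend_of_mem _ (hmaps hz)]
    rfl⟩

/-- `ω̂(r) = ∫_r^1 ω(s) ds`. -/
def hat (ω : ℝ → ℝ) (r : ℝ) : ℝ := ∫ s in r..1, ω s

/-- `ω : [0, 1) → ℝ` is (the radial profile of) a radial weight `z ↦ ω(|z|)`: it is non-negative,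
integrable over the disk, and `ω̂` does not vanish on `[0, 1)`. Since the integral of a
non-integrable function is `0` here, the last condition at `r = 0` also says that `ω̂(0)` is
finite; weights with `ω̂(0) = ∞` satisfy no upper doubling condition at `r = 0`. -/
structure IsRadialWeight (ω : ℝ → ℝ) : Prop where
  nonneg : ∀ r ∈ Ico (0 : ℝ) 1, 0 ≤ ω r
  integrable : Integrable (fun z : Disk => ω ‖(z : ℂ)‖) dA
  hat_ne_zero : ∀ r ∈ Ico (0 : ℝ) 1, hat ω r ≠ 0

/-- The upper doubling condition. -/
def UpperDoubling (ω : ℝ → ℝ) : Prop :=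
  ∃ C > (0 : ℝ), ∀ r ∈ Ico (0 : ℝ) 1, hat ω r ≤ C * hat ω ((1 + r) / 2)

/-- The lower doubling condition. -/
def LowerDoubling (ω : ℝ → ℝ) : Prop :=
  ∃ K > (1 : ℝ), ∃ C > (1 : ℝ), ∀ r ∈ Ico (0 : ℝ) 1, C * hat ω (1 - (1 - r) / K) ≤ hat ω r

/-- The class `𝓓` of two-sided doubling radial weights. -/
structure IsDoublingWeight (ω : ℝ → ℝ) : Prop where
  radialWeight : IsRadialWeight ω
  upper : UpperDoubling ω
  lower : LowerDoubling ω

/-- `ω_α(r) = (1 - r)^α ω(r)`. -/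
def powWeight (ω : ℝ → ℝ) (α : ℝ) (r : ℝ) : ℝ := (1 - r) ^ α * ω r

/-- Membership in the weighted Bergman space `A²_ω`. -/
def MemA2 (ω : ℝ → ℝ) (f : Hol) : Prop :=
  Integrable (fun ξ : Disk => ‖f ξ‖ ^ 2 * ω ‖(ξ : ℂ)‖) dA

/-- `K` is the reproducing kernel of `A²_ω` at `z`. -/
def IsBergmanKernel (ω : ℝ → ℝ) (z : Disk) (K : Hol) : Prop :=
  MemA2 ω K ∧
    ∀ f : Hol, MemA2 ω f → f z = ∫ ξ : Disk, f ξ * conj (K ξ) * (ω ‖(ξ : ℂ)‖ : ℂ) ∂dA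

/-- The Bergman kernel `B_z^ω`: the function in `A²_ω` with the reproducing property at `z`. -/
def bergmanKernel (ω : ℝ → ℝ) (z : Disk) : Hol := Classical.epsilon (IsBergmanKernel ω z)

/-- The integrand of the Bergman projection at `z`. -/
def projIntegrand (ω : ℝ → ℝ) (φ : Disk → ℂ) (z ξ : Disk) : ℂ :=
  φ ξ * conj (bergmanKernel ω z ξ) * (ω ‖(ξ : ℂ)‖ : ℂ)

/-- The Bergman projection `P_ω φ(z) = ∫ φ(ξ) conj(B_z^ω(ξ)) ω(ξ) dA(ξ)`. -/
def bergmanProj (ω : ℝ → ℝ) (φ : Disk → ℂ) (z : Disk) : ℂ :=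
  ∫ ξ : Disk, projIntegrand ω φ z ξ ∂dA

/-- The continuous linear operator `R : 𝓗 → 𝓗` commutes with dilatations and transforms the
Bergman kernels of `ω` into those of `ν`. -/
structure IsFracDeriv (ω ν : ℝ → ℝ) (R : Hol →L[ℂ] Hol) : Prop where
  dilate_comm : ∀ (r : Ioo (0 : ℝ) 1) (f : Hol), dilate r (R f) = R (dilate r f)
  map_kernel : ∀ z : Disk, R (bergmanKernel ω z) = bergmanKernel ν z

/-- The fractional derivative `R^{ω,ν}`: the operator characterized by `IsFracDeriv`. -/
def fracDeriv (ω ν : ℝ → ℝ) : Hol →L[ℂ] Hol := Classical.epsilon (IsFracDeriv ω ν)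

/-- Membership of an analytic function in the Bloch space. -/
def MemBloch (f : Hol) : Prop :=
  BddAbove (range fun z : Disk => (1 - ‖(z : ℂ)‖ ^ 2) * ‖derivative f z‖)

/-- The Bloch norm `sup_z (1 - |z|²)|f'(z)| + |f(0)|` of a Bloch function. -/
def blochNorm (f : Hol) : ℝ :=
  (⨆ z : Disk, (1 - ‖(z : ℂ)‖ ^ 2) * ‖derivative f z‖) + ‖f origin‖

/-- `g_α(z) = (1 - |z|)^α R^{ω,ω_α} h(z)`. -/
def gFun (ω : ℝ → ℝ) (α : ℝ) (h : Hol) (z : Disk) : ℂ :=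
  (((1 - ‖(z : ℂ)‖) ^ α : ℝ) : ℂ) * fracDeriv ω (powWeight ω α) h z

end BergmanBloch

end

open BergmanBloch

/-! Write `ω_n` for the moment `∫ r^n ω`. Orthogonality on circles gives the Bergman kernel the
series `∑ (conj z · ξ)^n / (2 ω_{2n+1})`, and forces `R^{ω,ω_α}` to be the coefficient multiplier
with `λ_n = ω_{2n+1} / (ω_α)_{2n+1}`. Everything then reduces to `L¹` bounds for two kernels of the
form `F(z · conj ξ)`.

Such bounds come from one device, `circleAverage_norm_tsum_le`. Since `(1 - w) F(w)` has the first
differences of the coefficients of `F` as its coefficients, `F` is a geometric series times the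
series of differences, and Cauchy-Schwarz with Parseval bounds its circular means. The weight enters
only through its moments. Upper doubling becomes `ω_n ≤ D ω_{2n+2}` (`exists_moment_le`), which
makes moments and their differences behave regularly. Lower doubling is used once, to bound the tail
integral of `ω_α` below by that of `ω` times `(1 - t)^α`; this yields `λ_n ≲ (n+1)^α`.

Boundedness: the derivative of `P_ω Φ` integrates `Φ ω` against a kernel whose circular mean at
radius `r` is `≲ 1 / ((1 - t) ω̂(t))` with `t = |z| r`. By `inv_le_tsum_pow_div_moment` this is `≲ ∑
t^n / ω_n`, and integrating in `r` against `ω` cancels every `ω_n`, leaving `∑ |z|^n = 1 / (1 -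
|z|)`.

Surjectivity: `R h (z)` equals a constant plus `z` times the integral of the bounded function `(1 -
|ξ|²) h'(ξ)` against a kernel with `L¹` norm `≲ (1 - |z|)^(-α)`, so `g_α` is bounded. As `g_α ω = (R
h) ω_α`, the multipliers cancel in the Taylor coefficients of `P_ω g_α`, which are those of `h`. -/

namespace BergmanBloch

/-! ### Power series on circles: orthogonality, Parseval, integral means. -/

open Real in
theorem circleAverage_monomial (k n : ℕ) (t : ℝ) :
    circleAverage (fun ξ : ℂ => ξ ^ k * conj ξ ^ n) 0 t = if k = n then (t : ℂ) ^ (2 * n) else 0 := by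
  have hpi : (2 * π : ℝ) ≠ 0 := by positivity
  have key : ∀ θ : ℝ, circleMap 0 t θ ^ k * conj (circleMap 0 t θ) ^ n
      = (t : ℂ) ^ (k + n) * Complex.exp ((((k : ℤ) - n : ℤ) * Complex.I : ℂ) * θ) := by
    intro θ
    have hc : conj (circleMap 0 t θ) = t * Complex.exp (-(θ * Complex.I)) := by
      simp [circleMap, ← Complex.exp_conj]
    rw [hc]
    simp only [circleMap, zero_add, mul_pow, ← Complex.exp_nat_mul]
    rw [mul_mul_mul_comm, ← pow_add, ← Complex.exp_add]
    congr 2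
    push_cast
    ring
  rw [circleAverage_def]
  simp only [key, intervalIntegral.integral_const_mul]
  split_ifs with h
  · subst h
    simp only [sub_self, Int.cast_zero, zero_mul, Complex.exp_zero,
      intervalIntegral.integral_const, sub_zero, two_mul]
    rw [Complex.real_smul, Complex.real_smul, mul_one, ← two_mul]
    push_cast
    field_simp
  · have hne : (((k : ℤ) - n : ℤ) * Complex.I : ℂ) ≠ 0 := by
      refine mul_ne_zero ?_ Complex.I_ne_zero
      rw [Int.cast_ne_zero, sub_ne_zero]
      exact_mod_cast h
    rw [integral_exp_mul_complex hne]
    have h1 : Complex.exp ((((k : ℤ) - n : ℤ) * Complex.I : ℂ) * ((2 * π : ℝ) : ℂ)) = 1 := by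
      rw [← Complex.exp_int_mul_two_pi_mul_I ((k : ℤ) - n)]
      congr 1
      push_cast
      ring
    rw [h1]
    simp

/-- Termwise averaging of a dominated series over a circle. -/
theorem hasSum_circleAverage {f : ℕ → ℂ → ℂ} {u : ℕ → ℝ} {t : ℝ} (hu : Summable u)
    (hf : ∀ n, ContinuousOn (f n) (Metric.sphere 0 |t|)) (hb : ∀ n, ∀ ξ : ℂ, ‖ξ‖ = |t| → ‖f n ξ‖ ≤ u n) :
    HasSum (fun n => Real.circleAverage (f n) 0 t)
      (Real.circleAverage (fun ξ => ∑' n, f n ξ) 0 t) := by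
  have hn : ∀ θ, ‖circleMap 0 t θ‖ = |t| := fun θ => by simp
  unfold Real.circleAverage
  refine HasSum.const_smul _ ?_
  refine intervalIntegral.hasSum_integral_of_dominated_convergence (bound := fun n _ => u n)
    (fun n => ((hf n).comp_continuous (continuous_circleMap 0 t)
      fun θ => by simp).aestronglyMeasurable) ?_ ?_ ?_ ?_
  · exact fun n => Filter.Eventually.of_forall fun θ _ => hb n _ (hn θ)
  · exact Filter.Eventually.of_forall fun θ _ => hu
  · exact intervalIntegrable_const
  · refine Filter.Eventually.of_forall fun θ _ => ?_
    exact (Summable.of_norm_bounded hu fun n => hb n _ (hn θ)).hasSum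

theorem continuousOn_tsum_pow {a : ℕ → ℂ} {t : ℝ} (ha : Summable fun n => ‖a n‖ * t ^ n) :
    ContinuousOn (fun ξ : ℂ => ∑' n, a n * ξ ^ n) (Metric.closedBall 0 t) := by
  refine continuousOn_tsum (fun n => by fun_prop) ha fun n ξ hξ => ?_
  rw [norm_mul, norm_pow]
  have : ‖ξ‖ ≤ t := by simpa using hξ
  gcongr

theorem summable_mul_pow_of_norm_le {a : ℕ → ℂ} {t : ℝ} (ha : Summable fun n => ‖a n‖ * t ^ n)
    {ξ : ℂ} (hξ : ‖ξ‖ ≤ t) : Summable fun n => a n * ξ ^ n := by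
  refine Summable.of_norm_bounded ha fun n => ?_
  rw [norm_mul, norm_pow]
  gcongr

theorem circleAverage_tsum_mul_conj_pow {a : ℕ → ℂ} {t : ℝ} (ht : 0 ≤ t)
    (ha : Summable fun n => ‖a n‖ * t ^ n) (n : ℕ) :
    Real.circleAverage (fun ξ : ℂ => (∑' k, a k * ξ ^ k) * conj ξ ^ n) 0 t
      = a n * (t : ℂ) ^ (2 * n) := by
  have h := hasSum_circleAverage (t := t) (f := fun k ξ => a k * (ξ ^ k * conj ξ ^ n))
    (ha.mul_right (t ^ n)) (fun k => by fun_prop) (fun k ξ hξ => by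
      rw [abs_of_nonneg ht] at hξ
      simp [hξ, mul_assoc])
  have e : ∀ k, Real.circleAverage (fun ξ : ℂ => a k * (ξ ^ k * conj ξ ^ n)) 0 t
      = if k = n then a n * (t : ℂ) ^ (2 * n) else 0 := by
    intro k
    have := Real.circleAverage_fun_smul (a := a k) (f := fun ξ : ℂ => ξ ^ k * conj ξ ^ n)
      (c := 0) (R := t)
    simp only [smul_eq_mul] at this
    rw [this, circleAverage_monomial]
    split_ifs with hk <;> simp [hk]
  simp only [e] at h
  have h2 := hasSum_ite_eq n (a n * (t : ℂ) ^ (2 * n))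
  rw [h2.unique h]
  congr 1
  ext ξ
  rw [← tsum_mul_right]
  simp only [mul_assoc]

/-- Parseval's identity on a circle. -/
theorem hasSum_circleAverage_norm_sq {a : ℕ → ℂ} {t : ℝ} (ht : 0 ≤ t)
    (ha : Summable fun n => ‖a n‖ * t ^ n) :
    HasSum (fun n => ‖a n‖ ^ 2 * t ^ (2 * n))
      (Real.circleAverage (fun ξ : ℂ => ‖∑' k, a k * ξ ^ k‖ ^ 2) 0 t) := by
  have hc := continuousOn_tsum_pow ha
  have hsub : Metric.sphere (0 : ℂ) |t| ⊆ Metric.closedBall 0 t := by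
    rw [abs_of_nonneg ht]
    exact Metric.sphere_subset_closedBall
  have h := hasSum_circleAverage (t := t)
    (f := fun n ξ => conj (a n) * ((∑' k, a k * ξ ^ k) * conj ξ ^ n))
    (ha.mul_right (∑' k, ‖a k‖ * t ^ k))
    (fun n => continuousOn_const.mul ((hc.mono hsub).mul (by fun_prop))) (fun n ξ hξ => by
      rw [abs_of_nonneg ht] at hξ
      have h1 : ‖∑' k, a k * ξ ^ k‖ ≤ ∑' k, ‖a k‖ * t ^ k :=
        tsum_of_norm_bounded ha.hasSum fun k => by simp [hξ]
      simp only [norm_mul, RCLike.norm_conj, norm_pow, hξ]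
      rw [mul_assoc, mul_comm (‖∑' k, a k * ξ ^ k‖)]
      gcongr)
  have e : ∀ n, Real.circleAverage
      (fun ξ : ℂ => conj (a n) * ((∑' k, a k * ξ ^ k) * conj ξ ^ n)) 0 t
      = ((‖a n‖ ^ 2 * t ^ (2 * n) : ℝ) : ℂ) := by
    intro n
    have := Real.circleAverage_fun_smul (a := conj (a n))
      (f := fun ξ : ℂ => (∑' k, a k * ξ ^ k) * conj ξ ^ n) (c := 0) (R := t)
    simp only [smul_eq_mul] at this
    rw [this, circleAverage_tsum_mul_conj_pow ht ha, ← mul_assoc, Complex.conj_mul']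
    push_cast
    rfl
  simp only [e] at h
  have e2 : Real.circleAverage
      (fun ξ : ℂ => ∑' n, conj (a n) * ((∑' k, a k * ξ ^ k) * conj ξ ^ n)) 0 t
      = ((Real.circleAverage (fun ξ : ℂ => ‖∑' k, a k * ξ ^ k‖ ^ 2) 0 t : ℝ) : ℂ) := by
    have : (fun ξ : ℂ => ∑' n, conj (a n) * ((∑' k, a k * ξ ^ k) * conj ξ ^ n))
        = fun ξ : ℂ => ((‖∑' k, a k * ξ ^ k‖ ^ 2 : ℝ) : ℂ) := by
      ext ξ
      push_cast
      rw [← Complex.mul_conj', Complex.conj_tsum, ← tsum_mul_left]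
      congr 1
      ext n
      simp only [map_mul, map_pow]
      ring
    rw [this]
    simp only [Real.circleAverage_def, smul_eq_mul, Complex.real_smul]
    rw [intervalIntegral.integral_ofReal]
    push_cast
    rfl
  rw [e2] at h
  exact Complex.hasSum_ofReal.1 h

/-- The sequence of first differences, with the convention `a (-1) = 0`. -/
def firstDiff (a : ℕ → ℂ) : ℕ → ℂ
  | 0 => a 0
  | n + 1 => a (n + 1) - a n

/-- Summation by parts. The value 0 at index -1 absorbs the boundary term, so the factor `1 / (1 -
w)` splits off exactly. -/
theorem one_sub_mul_tsum_pow {a : ℕ → ℂ} {w : ℂ} (ha : Summable fun n => a n * w ^ n) :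
    HasSum (fun n => firstDiff a n * w ^ n) ((1 - w) * ∑' n, a n * w ^ n) := by
  have h1 : HasSum (fun n => a (n + 1) * w ^ (n + 1)) (∑' n, a n * w ^ n - a 0) := by
    have := (hasSum_nat_add_iff' 1).2 ha.hasSum
    simpa using this
  have h2 := h1.sub (ha.hasSum.mul_left w)
  have h3 : HasSum (fun n => firstDiff a (n + 1) * w ^ (n + 1))
      ((1 - w) * ∑' n, a n * w ^ n - a 0) := by
    rw [show (1 - w) * ∑' n, a n * w ^ n - a 0
      = ∑' n, a n * w ^ n - a 0 - w * ∑' n, a n * w ^ n by ring]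
    have e : (fun n => firstDiff a (n + 1) * w ^ (n + 1))
        = fun n => a (n + 1) * w ^ (n + 1) - w * (a n * w ^ n) := by
      ext n
      simp only [firstDiff]
      ring
    rwa [e]
  have := (hasSum_nat_add_iff (f := fun n => firstDiff a n * w ^ n) 1).1 h3
  simpa [firstDiff] using this

/-- A bound on the first differences of the coefficients bounds the integral means of order one. -/
theorem circleAverage_norm_tsum_le {a : ℕ → ℂ} {z : ℂ} {r Q : ℝ} (hr : 0 ≤ r)
    (ht : ‖z‖ * r < 1) (ha : Summable fun n => ‖a n‖ * (‖z‖ * r) ^ n) (hQ : 0 < Q)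
    (hd : ∀ n, (‖firstDiff a n‖ * (‖z‖ * r) ^ n) ^ 2 ≤ Q ^ 2 * (‖z‖ * r) ^ n) :
    Real.circleAverage (fun ξ : ℂ => ‖∑' n, a n * (z * ξ) ^ n‖) 0 r ≤ Q / (1 - ‖z‖ * r) := by
  set t := ‖z‖ * r with htdef
  have ht0 : 0 ≤ t := by positivity
  have hds : Summable fun n => ‖firstDiff a n‖ * t ^ n := by
    have h1 : Summable fun n => a n * (t : ℂ) ^ n :=
      summable_mul_pow_of_norm_le ha (by simp [abs_of_nonneg ht0])
    simpa [abs_of_nonneg ht0] using (one_sub_mul_tsum_pow h1).summable.norm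
  have hgeo : Summable fun n : ℕ => t ^ n := summable_geometric_of_lt_one ht0 ht
  have cont : ∀ b : ℕ → ℂ, (Summable fun n => ‖b n‖ * r ^ n) →
      ContinuousOn (fun ξ : ℂ => ∑' n, b n * ξ ^ n) (Metric.sphere 0 |r|) := fun b hb => by
    rw [abs_of_nonneg hr]
    exact (continuousOn_tsum_pow hb).mono Metric.sphere_subset_closedBall
  have hA : Summable fun n => ‖a n * z ^ n‖ * r ^ n := by
    convert ha using 2
    rw [norm_mul, norm_pow, htdef, mul_pow, mul_assoc]
  have hB : Summable fun n => ‖firstDiff a n * z ^ n‖ * r ^ n := by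
    convert hds using 2
    rw [norm_mul, norm_pow, htdef, mul_pow, mul_assoc]
  have hC : Summable fun n => ‖z ^ n‖ * r ^ n := by
    convert hgeo using 2
    rw [norm_pow, htdef, mul_pow]
  have pB := hasSum_circleAverage_norm_sq hr hB
  have pC := hasSum_circleAverage_norm_sq hr hC
  have bB : Real.circleAverage (fun ξ : ℂ => ‖∑' k, firstDiff a k * z ^ k * ξ ^ k‖ ^ 2) 0 r
      ≤ Q ^ 2 / (1 - t) := by
    have := (hasSum_geometric_of_lt_one ht0 ht).mul_left (Q ^ 2)
    refine (hasSum_le (fun n => ?_) pB this).trans_eq (by rw [div_eq_mul_inv])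
    refine le_trans (le_of_eq ?_) (hd n)
    rw [norm_mul, norm_pow, htdef]
    ring
  have bC : Real.circleAverage (fun ξ : ℂ => ‖∑' k, z ^ k * ξ ^ k‖ ^ 2) 0 r ≤ 1 / (1 - t) := by
    have := hasSum_geometric_of_lt_one ht0 ht
    refine (hasSum_le (fun n => ?_) pC this).trans_eq (by rw [one_div])
    have e : ‖z ^ n‖ ^ 2 * r ^ (2 * n) = t ^ (2 * n) := by
      rw [norm_pow, htdef]
      ring
    rw [e]
    exact pow_le_pow_of_le_one ht0 ht.le (by omega)
  have iB : CircleIntegrable (fun ξ : ℂ => ‖∑' k, firstDiff a k * z ^ k * ξ ^ k‖ ^ 2) 0 r :=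
    ContinuousOn.circleIntegrable' ((cont _ hB).norm.pow 2)
  have iC : CircleIntegrable (fun ξ : ℂ => ‖∑' k, z ^ k * ξ ^ k‖ ^ 2) 0 r :=
    ContinuousOn.circleIntegrable' ((cont _ hC).norm.pow 2)
  have iA : CircleIntegrable (fun ξ : ℂ => ‖∑' n, a n * (z * ξ) ^ n‖) 0 r := by
    simp only [mul_pow, ← mul_assoc]
    exact ContinuousOn.circleIntegrable' (cont _ hA).norm
  -- The series is the product of the geometric series and the difference series. The inequality `x
  -- y ≤ (Q x² + y² / Q) / 2` stands in for Cauchy-Schwarz; with this `Q` the two halves have the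
  -- same bound.
  have hle : Real.circleAverage (fun ξ : ℂ => ‖∑' n, a n * (z * ξ) ^ n‖) 0 r
      ≤ Real.circleAverage ((Q / 2) • (fun ξ : ℂ => ‖∑' k, z ^ k * ξ ^ k‖ ^ 2)
        + (Q⁻¹ / 2) • (fun ξ : ℂ => ‖∑' k, firstDiff a k * z ^ k * ξ ^ k‖ ^ 2)) 0 r := by
    refine Real.circleAverage_mono iA ((iC.const_smul).add (iB.const_smul)) fun ξ hξ => ?_
    have hξ' : ‖ξ‖ = r := by simpa [abs_of_nonneg hr] using hξ
    have hw : ‖z * ξ‖ = t := by rw [norm_mul, hξ']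
    have hw1 : ‖z * ξ‖ < 1 := hw ▸ ht
    have e1 := (one_sub_mul_tsum_pow (w := z * ξ) (summable_mul_pow_of_norm_le ha hw.le)).tsum_eq
    have e2 := tsum_geometric_of_norm_lt_one hw1
    have hne : 1 - z * ξ ≠ 0 := by
      intro h0
      rw [sub_eq_zero] at h0
      rw [← h0] at hw1
      simp at hw1
    have e3 : ∑' n, a n * (z * ξ) ^ n
        = (∑' k, z ^ k * ξ ^ k) * ∑' k, firstDiff a k * z ^ k * ξ ^ k := by
      simp only [mul_assoc, ← mul_pow]
      rw [e1, e2, inv_mul_cancel_left₀ hne]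
    rw [e3, norm_mul]
    simp only [Pi.add_apply, Pi.smul_apply, smul_eq_mul]
    set x := ‖∑' k, z ^ k * ξ ^ k‖
    set y := ‖∑' k, firstDiff a k * z ^ k * ξ ^ k‖
    have : Q / 2 * x ^ 2 + Q⁻¹ / 2 * y ^ 2 - x * y = Q⁻¹ / 2 * (Q * x - y) ^ 2 := by
      field_simp
      ring
    have h2 : 0 ≤ Q⁻¹ / 2 * (Q * x - y) ^ 2 := by positivity
    linarith
  refine hle.trans ?_
  rw [Real.circleAverage_add iC.const_smul iB.const_smul, Real.circleAverage_smul,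
    Real.circleAverage_smul, smul_eq_mul, smul_eq_mul]
  have h1t : 0 < 1 - t := by linarith
  calc _ ≤ Q / 2 * (1 / (1 - t)) + Q⁻¹ / 2 * (Q ^ 2 / (1 - t)) := by gcongr
    _ = Q / (1 - t) := by field_simp; norm_num

/-! ### Moments of a radial weight and the upper doubling condition. -/

/-- The moment `∫_0^1 r^n W(r) dr`. -/
noncomputable def moment (W : ℝ → ℝ) (n : ℕ) : ℝ := ∫ r in (0 : ℝ)..1, r ^ n * W r

namespace IsRadialWeight

variable {W : ℝ → ℝ}

/-- An undefined integral has the value 0, which the condition on `hat` at 0 excludes. -/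
theorem intervalIntegrable (hW : IsRadialWeight W) : IntervalIntegrable W volume 0 1 := by
  by_contra h
  exact hW.hat_ne_zero 0 (by simp) (intervalIntegral.integral_undef h)

theorem intervalIntegrable_mul (hW : IsRadialWeight W) {g : ℝ → ℝ} (hg : Continuous g) {a b : ℝ}
    (ha : a ∈ Icc (0 : ℝ) 1) (hb : b ∈ Icc (0 : ℝ) 1) :
    IntervalIntegrable (fun r => g r * W r) volume a b := by
  refine (IntervalIntegrable.continuousOn_mul ?_ hg.continuousOn)
  refine hW.intervalIntegrable.mono_set ?_
  rw [uIcc_of_le (zero_le_one' ℝ)]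
  exact uIcc_subset_Icc ha hb

theorem integral_mul_mono (hW : IsRadialWeight W) {g h : ℝ → ℝ} (hg : Continuous g)
    (hh : Continuous h) {a b : ℝ} (ha : 0 ≤ a) (hab : a ≤ b) (hb : b ≤ 1)
    (hgh : ∀ r ∈ Ioo a b, g r ≤ h r) :
    ∫ r in a..b, g r * W r ≤ ∫ r in a..b, h r * W r := by
  refine intervalIntegral.integral_mono_on_of_le_Ioo hab
    (hW.intervalIntegrable_mul hg ⟨ha, hab.trans hb⟩ ⟨ha.trans hab, hb⟩)
    (hW.intervalIntegrable_mul hh ⟨ha, hab.trans hb⟩ ⟨ha.trans hab, hb⟩) fun r hr => ?_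
  exact mul_le_mul_of_nonneg_right (hgh r hr)
    (hW.nonneg r ⟨ha.trans hr.1.le, hr.2.trans_le hb⟩)

theorem integral_mul_nonneg (hW : IsRadialWeight W) {g : ℝ → ℝ} (hg : Continuous g)
    {a b : ℝ} (ha : 0 ≤ a) (hab : a ≤ b) (hb : b ≤ 1) (hg0 : ∀ r ∈ Ioo a b, 0 ≤ g r) :
    0 ≤ ∫ r in a..b, g r * W r := by
  have := hW.integral_mul_mono (g := fun _ => 0) continuous_const hg ha hab hb hg0
  simpa using this

theorem integral_mul_split (hW : IsRadialWeight W) {g : ℝ → ℝ} (hg : Continuous g) {t : ℝ}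
    (ht : t ∈ Icc (0 : ℝ) 1) :
    ∫ r in (0 : ℝ)..1, g r * W r = (∫ r in (0 : ℝ)..t, g r * W r) + ∫ r in t..1, g r * W r :=
  (intervalIntegral.integral_add_adjacent_intervals
    (hW.intervalIntegrable_mul hg (by simp) ht)
    (hW.intervalIntegrable_mul hg ht (by simp))).symm

theorem hat_pos (hW : IsRadialWeight W) {t : ℝ} (h0 : 0 ≤ t) (h1 : t < 1) : 0 < hat W t := by
  refine lt_of_le_of_ne ?_ (hW.hat_ne_zero t ⟨h0, h1⟩).symm
  have := hW.integral_mul_nonneg (g := fun _ => 1) continuous_const h0 h1.le le_rfl (by simp)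
  simpa [hat] using this

/-- Only the mass on `[t, 1]` is kept, where `r^n ≥ t^n`. -/
theorem pow_mul_hat_le_moment (hW : IsRadialWeight W) {t : ℝ} (h0 : 0 ≤ t) (h1 : t < 1) (n : ℕ) :
    t ^ n * hat W t ≤ moment W n := by
  rw [moment, hW.integral_mul_split (continuous_pow n) ⟨h0, h1.le⟩, hat,
    ← intervalIntegral.integral_const_mul]
  have h2 := hW.integral_mul_nonneg (g := fun r => r ^ n) (by fun_prop) le_rfl h0 h1.le
    (fun r hr => pow_nonneg hr.1.le _)
  have h3 := hW.integral_mul_mono (g := fun _ => t ^ n) (h := fun r => r ^ n) (by fun_prop)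
    (by fun_prop) h0 h1.le le_rfl (fun r hr => pow_le_pow_left₀ h0 hr.1.le _)
  linarith

theorem moment_pos (hW : IsRadialWeight W) (n : ℕ) : 0 < moment W n :=
  lt_of_lt_of_le (mul_pos (pow_pos (by norm_num) n) (hW.hat_pos (by norm_num) (by norm_num)))
    (hW.pow_mul_hat_le_moment (t := 1 / 2) (by norm_num) (by norm_num) n)

theorem moment_antitone (hW : IsRadialWeight W) : Antitone (moment W) := fun _ _ h =>
  hW.integral_mul_mono (by fun_prop) (by fun_prop) le_rfl zero_le_one le_rfl
    fun _ hr => pow_le_pow_of_le_one hr.1.le hr.2.le h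

/-- Below `t` the extra power is at most `t^j`; above `t` all powers are at most 1. When `t^j` is
small the first term can be absorbed, which bounds a moment above by `hat W t`. -/
theorem moment_add_le (hW : IsRadialWeight W) {t : ℝ} (h0 : 0 ≤ t) (h1 : t < 1) (j k : ℕ) :
    moment W (j + k) ≤ t ^ j * moment W k + hat W t := by
  rw [moment, hW.integral_mul_split (continuous_pow _) ⟨h0, h1.le⟩, moment,
    hW.integral_mul_split (continuous_pow _) ⟨h0, h1.le⟩]
  have h2 : ∫ r in t..1, r ^ (j + k) * W r ≤ hat W t := by
    have := hW.integral_mul_mono (g := fun r => r ^ (j + k)) (h := fun _ => 1) (by fun_prop)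
      (by fun_prop) h0 h1.le le_rfl
      (fun r hr => pow_le_one₀ (h0.trans hr.1.le) hr.2.le)
    simpa [hat] using this
  have h3 : ∫ r in (0 : ℝ)..t, r ^ (j + k) * W r ≤ t ^ j * ∫ r in (0 : ℝ)..t, r ^ k * W r := by
    rw [← intervalIntegral.integral_const_mul]
    have := hW.integral_mul_mono (g := fun r => r ^ (j + k)) (h := fun r => t ^ j * r ^ k)
      (by fun_prop) (by fun_prop) le_rfl h0 h1.le (fun r hr => by
        rw [pow_add]
        have := hr.1.le
        have := hr.2.le
        gcongr)
    simpa [mul_assoc] using this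
  have h4 := hW.integral_mul_nonneg (g := fun r => r ^ k) (by fun_prop) h0 h1.le le_rfl
    (fun r hr => pow_nonneg (h0.trans hr.1.le) _)
  have h5 : 0 ≤ t ^ j * ∫ r in t..1, r ^ k * W r := mul_nonneg (pow_nonneg h0 _) h4
  rw [mul_add]
  linarith

/-- The measure `W(r) dr` on `(0, 1)`. -/
noncomputable def _root_.BergmanBloch.radialMeasure (W : ℝ → ℝ) : Measure ℝ :=
  (volume.restrict (Ioo 0 1)).withDensity fun r => ENNReal.ofReal (W r)

theorem integrableOn (hW : IsRadialWeight W) : IntegrableOn W (Ioo 0 1) :=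
  ((intervalIntegrable_iff_integrableOn_Ioo_of_le zero_le_one).1 hW.intervalIntegrable)

theorem radialMeasure_Ici (hW : IsRadialWeight W) {t : ℝ} (h0 : 0 ≤ t) (h1 : t < 1) :
    radialMeasure W (Ici t) = ENNReal.ofReal (hat W t) := by
  have hs : (Ici t ∩ Ioo 0 1 : Set ℝ) =ᵐ[volume] Ioo t 1 := by
    have : (Ici t ∩ Ioo 0 1 : Set ℝ) =ᵐ[volume] (Ioi t ∩ Ioo 0 1 : Set ℝ) :=
      Ioi_ae_eq_Ici.symm.inter (ae_eq_refl _)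
    have e : (Ioi t ∩ Ioo 0 1 : Set ℝ) = Ioo t 1 := by
      ext x
      simp only [mem_inter_iff, mem_Ioi, mem_Ioo]
      exact ⟨fun h => ⟨h.1, h.2.2⟩, fun h => ⟨h.1, h0.trans_lt h.1, h.2⟩⟩
    rwa [e] at this
  rw [radialMeasure, withDensity_apply _ measurableSet_Ici, Measure.restrict_restrict
    measurableSet_Ici, Measure.restrict_congr_set hs, hat,
    intervalIntegral.integral_of_le h1.le, integral_Ioc_eq_integral_Ioo,
    ofReal_integral_eq_lintegral_ofReal]
  · exact hW.integrableOn.mono_set (Ioo_subset_Ioo_left h0)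
  · refine (ae_restrict_iff' measurableSet_Ioo).2 (Filter.Eventually.of_forall fun r hr => ?_)
    exact hW.nonneg r ⟨h0.trans hr.1.le, hr.2⟩

theorem lintegral_radialMeasure_pow (hW : IsRadialWeight W) (n : ℕ) :
    ∫⁻ r, ENNReal.ofReal (r ^ n) ∂radialMeasure W = ENNReal.ofReal (moment W n) := by
  rw [radialMeasure, lintegral_withDensity_eq_lintegral_mul₀
    (hW.integrableOn.aestronglyMeasurable.aemeasurable.ennreal_ofReal) (by fun_prop), moment,
    intervalIntegral.integral_of_le zero_le_one, integral_Ioc_eq_integral_Ioo,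
    ofReal_integral_eq_lintegral_ofReal]
  · refine setLIntegral_congr_fun measurableSet_Ioo fun r hr => ?_
    simp only [Pi.mul_apply]
    rw [ENNReal.ofReal_mul (pow_nonneg hr.1.le _), mul_comm]
  · exact ((intervalIntegrable_iff_integrableOn_Ioo_of_le zero_le_one).1
      (hW.intervalIntegrable_mul (continuous_pow n) (by simp) (by simp)))
  · refine (ae_restrict_iff' measurableSet_Ioo).2 (Filter.Eventually.of_forall fun r hr => ?_)
    exact mul_nonneg (pow_nonneg hr.1.le _) (hW.nonneg r ⟨hr.1.le, hr.2⟩)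

theorem ae_mem_radialMeasure (W : ℝ → ℝ) : ∀ᵐ r ∂radialMeasure W, r ∈ Ioo (0 : ℝ) 1 :=
  (withDensity_absolutelyContinuous _ _).ae_le (ae_restrict_mem measurableSet_Ioo)

/-- Layer-cake formula: the doubling condition compares the level sets of `r^n` and `r^(2n)` at each
height `s = t^n`, because `r ≥ (1 + t) / 2` implies `r² ≥ 2 r - 1 ≥ t`. -/
theorem moment_le_mul_moment_two_mul (hW : IsRadialWeight W) {C : ℝ} (hC : 0 < C)
    (hu : ∀ r ∈ Ico (0 : ℝ) 1, hat W r ≤ C * hat W ((1 + r) / 2)) {n : ℕ} (hn : n ≠ 0) :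
    moment W n ≤ C * moment W (2 * n) := by
  have hae := ae_mem_radialMeasure W
  have key : ∀ s ∈ Ioi (0 : ℝ), radialMeasure W {x | s ≤ x ^ n}
      ≤ ENNReal.ofReal C * radialMeasure W {x | s ≤ x ^ (2 * n)} := by
    intro s hs
    have hs : 0 < s := hs
    rcases le_or_gt 1 s with h1 | h1
    · have : radialMeasure W {x | s ≤ x ^ n} = 0 := by
        refine measure_eq_zero_iff_ae_notMem.2 (hae.mono fun x hx hsx => ?_)
        exact (h1.trans hsx).not_gt (pow_lt_one₀ hx.1.le hx.2 hn)
      simp [this]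
    · set t := s ^ ((n : ℝ)⁻¹) with ht
      have ht0 : 0 ≤ t := Real.rpow_nonneg hs.le _
      have htn : t ^ n = s := Real.rpow_inv_natCast_pow hs.le hn
      have ht1 : t < 1 := Real.rpow_lt_one hs.le h1 (by positivity)
      calc radialMeasure W {x | s ≤ x ^ n} ≤ radialMeasure W (Ici t) := by
            refine measure_mono_ae (hae.mono fun x hx hsx => ?_)
            have : t ^ n ≤ x ^ n := htn ▸ hsx
            exact le_of_pow_le_pow_left₀ hn hx.1.le this
        _ ≤ ENNReal.ofReal C * radialMeasure W (Ici ((1 + t) / 2)) := by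
            rw [hW.radialMeasure_Ici ht0 ht1, hW.radialMeasure_Ici (by linarith) (by linarith),
              ← ENNReal.ofReal_mul hC.le]
            exact ENNReal.ofReal_le_ofReal (hu t ⟨ht0, ht1⟩)
        _ ≤ ENNReal.ofReal C * radialMeasure W {x | s ≤ x ^ (2 * n)} := by
            gcongr
            intro x hx
            have hx : (1 + t) / 2 ≤ x := hx
            change s ≤ x ^ (2 * n)
            rw [← htn, pow_mul]
            exact pow_le_pow_left₀ ht0 (by nlinarith [sq_nonneg (x - 1)]) _
  have h1 : ∫⁻ r, ENNReal.ofReal (r ^ n) ∂radialMeasure W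
      ≤ ENNReal.ofReal C * ∫⁻ r, ENNReal.ofReal (r ^ (2 * n)) ∂radialMeasure W := by
    rw [lintegral_eq_lintegral_meas_le _ (hae.mono fun x hx => pow_nonneg hx.1.le _) (by fun_prop),
      lintegral_eq_lintegral_meas_le _ (hae.mono fun x hx => pow_nonneg hx.1.le _) (by fun_prop),
      ← lintegral_const_mul' _ _ ENNReal.ofReal_ne_top]
    exact setLIntegral_mono' measurableSet_Ioi key
  rw [hW.lintegral_radialMeasure_pow, hW.lintegral_radialMeasure_pow,
    ← ENNReal.ofReal_mul hC.le] at h1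
  exact (ENNReal.ofReal_le_ofReal_iff (mul_nonneg hC.le (hW.moment_pos _).le)).1 h1

theorem exists_moment_le (hW : IsRadialWeight W) (hu : UpperDoubling W) :
    ∃ D : ℝ, 1 ≤ D ∧ ∀ n, moment W n ≤ D * moment W (2 * n + 2) := by
  obtain ⟨C, hC, hu⟩ := hu
  -- Two doublings reach the index `4 n ≥ 2 n + 2` when `n ≥ 1`; the ratio of moments takes care of
  -- `n = 0`, where the layer-cake argument does not apply.
  refine ⟨max (max 1 (C * C)) (moment W 0 / moment W 2), by simp, fun n => ?_⟩
  rcases Nat.eq_zero_or_pos n with rfl | hn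
  · calc moment W 0 = moment W 0 / moment W 2 * moment W 2 :=
        (div_mul_cancel₀ _ (hW.moment_pos 2).ne').symm
      _ ≤ _ := mul_le_mul_of_nonneg_right (le_max_right _ _) (hW.moment_pos 2).le
  · calc moment W n ≤ C * moment W (2 * n) := hW.moment_le_mul_moment_two_mul hC hu hn.ne'
      _ ≤ C * (C * moment W (2 * (2 * n))) := by
        gcongr
        exact hW.moment_le_mul_moment_two_mul hC hu (by omega)
      _ ≤ C * (C * moment W (2 * n + 2)) := by
        gcongr
        exact hW.moment_antitone (by omega)
      _ = C * C * moment W (2 * n + 2) := by ring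
      _ ≤ _ := mul_le_mul_of_nonneg_right ((le_max_right _ _).trans (le_max_left _ _))
        (hW.moment_pos _).le

end IsRadialWeight

/-! ### Power series converging in the disk. -/

/-- With `x = (n + 1)(1 - t)` the quantity is `t^n x^β`, where `t^n ≤ e · exp(-x)` while `x^β` is at
most a constant times `exp x`. -/
theorem exists_rpow_mul_pow_le {β : ℝ} (hβ : 0 ≤ β) :
    ∃ C : ℝ, 0 < C ∧ ∀ (n : ℕ) (t : ℝ), 0 ≤ t → t ≤ 1 →
      ((n : ℝ) + 1) ^ β * (t ^ n * (1 - t) ^ β) ≤ C := by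
  set k := ⌈β⌉₊
  have hk : (0 : ℝ) < (k.factorial : ℝ) := by exact_mod_cast k.factorial_pos
  refine ⟨Real.exp 1 * (1 + k.factorial), by positivity, fun n t h0 h1 => ?_⟩
  set x : ℝ := ((n : ℝ) + 1) * (1 - t) with hx
  have hx0 : 0 ≤ x := mul_nonneg (by positivity) (by linarith)
  have h2 : x ^ β ≤ (1 + k.factorial) * Real.exp x := by
    rcases le_or_gt x 1 with hx1 | hx1
    · have h3 : x ^ β ≤ 1 := Real.rpow_le_one hx0 hx1 hβ
      have h4 : 1 ≤ Real.exp x := Real.one_le_exp hx0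
      nlinarith
    · have h3 : x ^ β ≤ x ^ (k : ℝ) := Real.rpow_le_rpow_of_exponent_le hx1.le (Nat.le_ceil β)
      rw [Real.rpow_natCast] at h3
      have h4 := Real.pow_div_factorial_le_exp x hx0 k
      rw [div_le_iff₀ hk] at h4
      have h5 := Real.exp_pos x
      nlinarith
  have h3 : t ^ n ≤ Real.exp 1 * Real.exp (-x) := by
    have h4 : t ≤ Real.exp (t - 1) := by linarith [Real.add_one_le_exp (t - 1)]
    calc t ^ n ≤ Real.exp (t - 1) ^ n := pow_le_pow_left₀ h0 h4 n
      _ = Real.exp (n * (t - 1)) := by rw [← Real.exp_nat_mul]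
      _ ≤ Real.exp (1 + -x) := by
        rw [Real.exp_le_exp, hx]
        nlinarith
      _ = _ := Real.exp_add _ _
  calc ((n : ℝ) + 1) ^ β * (t ^ n * (1 - t) ^ β) = t ^ n * x ^ β := by
        rw [hx, Real.mul_rpow (by positivity) (by linarith)]
        ring
    _ ≤ (Real.exp 1 * Real.exp (-x)) * ((1 + k.factorial) * Real.exp x) := by gcongr
    _ = Real.exp 1 * (1 + k.factorial) * (Real.exp (-x) * Real.exp x) := by ring
    _ = _ := by rw [← Real.exp_add]; simp

/-- The power series with coefficients `a` converges absolutely in the unit disk. -/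
def SummableOnDisk (a : ℕ → ℂ) : Prop :=
  ∀ t : ℝ, 0 ≤ t → t < 1 → Summable fun n => ‖a n‖ * t ^ n

theorem SummableOnDisk.of_norm_le {a b : ℕ → ℂ} (ha : SummableOnDisk a) {C : ℝ}
    (h : ∀ n, ‖b n‖ ≤ C * ‖a n‖) : SummableOnDisk b := fun t h0 h1 => by
  refine Summable.of_nonneg_of_le (fun n => by positivity) (fun n => ?_)
    ((ha t h0 h1).mul_left C)
  rw [← mul_assoc]
  exact mul_le_mul_of_nonneg_right (h n) (pow_nonneg h0 n)

/-- Polynomial growth is absorbed by comparing the series at `t` with the series at a larger radius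
`s < 1`. -/
theorem SummableOnDisk.of_norm_le_rpow {a b : ℕ → ℂ} (ha : SummableOnDisk a) {C β : ℝ}
    (hβ : 0 ≤ β) (h : ∀ n, ‖b n‖ ≤ C * ((n : ℝ) + 1) ^ β * ‖a n‖) :
    SummableOnDisk b := fun t h0 h1 => by
  obtain ⟨C', hC', hb⟩ := exists_rpow_mul_pow_le hβ
  set s := (1 + t) / 2 with hs
  have hs0 : 0 < s := by linarith
  have hs1 : s < 1 := by linarith
  set q := t / s with hq
  have hq0 : 0 ≤ q := by positivity
  have hq1 : q < 1 := by rw [hq, div_lt_one hs0]; linarith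
  have h1q : 0 < (1 - q) ^ β := Real.rpow_pos_of_pos (by linarith) _
  refine Summable.of_nonneg_of_le (fun n => by positivity) (fun n => ?_)
    ((ha s hs0.le hs1).mul_left (|C| * (C' / (1 - q) ^ β)))
  have h3 : ((n : ℝ) + 1) ^ β * q ^ n ≤ C' / (1 - q) ^ β := by
    rw [le_div_iff₀ h1q, mul_assoc]
    exact hb n q hq0 hq1.le
  have h4 : t ^ n = q ^ n * s ^ n := by rw [hq, ← mul_pow, div_mul_cancel₀ _ hs0.ne']
  calc ‖b n‖ * t ^ n ≤ C * ((n : ℝ) + 1) ^ β * ‖a n‖ * t ^ n := by gcongr; exact h n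
    _ ≤ |C| * ((n : ℝ) + 1) ^ β * ‖a n‖ * t ^ n := by gcongr; exact le_abs_self C
    _ = |C| * (((n : ℝ) + 1) ^ β * q ^ n) * (‖a n‖ * s ^ n) := by rw [h4]; ring
    _ ≤ |C| * (C' / (1 - q) ^ β) * (‖a n‖ * s ^ n) := by gcongr

theorem SummableOnDisk.shift {a : ℕ → ℂ} (ha : SummableOnDisk a) :
    SummableOnDisk fun n => a (n + 1) := fun t h0 h1 => by
  rcases h0.eq_or_lt with rfl | h0'
  · exact summable_of_ne_finset_zero (s := {0}) fun n hn => by simp_all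
  · have h2 := ((summable_nat_add_iff 1).2 (ha t h0 h1)).mul_left t⁻¹
    refine h2.congr fun n => ?_
    rw [pow_succ]
    field_simp

theorem SummableOnDisk.summable {a : ℕ → ℂ} (ha : SummableOnDisk a) {z : ℂ} (hz : ‖z‖ < 1) :
    Summable fun n => a n * z ^ n :=
  summable_mul_pow_of_norm_le (ha ‖z‖ (norm_nonneg z) hz) le_rfl

/-! ### Moment estimates under doubling of the moments. -/

namespace IsRadialWeight

variable {W : ℝ → ℝ}

/-- For `t < s < 1` the moment is at least `s^n` times a positive constant, so the terms are
dominated by `(t / s)^n`. -/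
theorem summable_pow_div_moment (hW : IsRadialWeight W) {t : ℝ} (h0 : 0 ≤ t) (h1 : t < 1) :
    Summable fun n => t ^ n / moment W n := by
  set s := (1 + t) / 2 with hs
  have hs0 : 0 < s := by linarith
  have hs1 : s < 1 := by linarith
  have hh := hW.hat_pos hs0.le hs1
  refine Summable.of_nonneg_of_le (fun n => div_nonneg (pow_nonneg h0 n) (hW.moment_pos n).le)
    (fun n => ?_) ((summable_geometric_of_lt_one (r := t / s) (by positivity)
      (by rw [div_lt_one hs0]; linarith)).mul_right (hat W s)⁻¹)
  rw [div_pow, ← div_eq_mul_inv, div_div]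
  gcongr
  exact hW.pow_mul_hat_le_moment hs0.le hs1 n

/-- The Taylor coefficients of the Bergman kernel. -/
noncomputable def _root_.BergmanBloch.kernelCoeff (W : ℝ → ℝ) (n : ℕ) : ℝ :=
  (2 * moment W (2 * n + 1))⁻¹

theorem kernelCoeff_pos (hW : IsRadialWeight W) (n : ℕ) : 0 < kernelCoeff W n :=
  inv_pos.2 (mul_pos two_pos (hW.moment_pos _))

/-- Up to a constant factor the terms are the odd-index terms of the preceding series at `√t`. -/
theorem summableOnDisk_kernelCoeff (hW : IsRadialWeight W) :
    SummableOnDisk fun n => (kernelCoeff W n : ℂ) := fun t h0 h1 => by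
  have h2 : Real.sqrt t < 1 := by rw [Real.sqrt_lt' one_pos]; simpa using h1
  rcases h0.eq_or_lt with rfl | h0'
  · exact summable_of_ne_finset_zero (s := {0}) fun n hn => by simp_all
  have hst : 0 < Real.sqrt t := Real.sqrt_pos.2 h0'
  have h3 := (hW.summable_pow_div_moment hst.le h2).comp_injective
    (i := fun n : ℕ => 2 * n + 1) (fun a b h => by simpa using h)
  refine (h3.mul_left ((Real.sqrt t)⁻¹ / 2)).congr fun n => ?_
  simp only [Function.comp_apply]
  rw [Complex.norm_real, Real.norm_of_nonneg (hW.kernelCoeff_pos n).le, kernelCoeff, pow_succ,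
    pow_mul, Real.sq_sqrt h0]
  have := hW.moment_pos (2 * n + 1)
  field_simp

/-- Half of the powers of `t` turn `hat W t` into a moment of order `n / 2`, which two doublings
raise to order `2 n + 1`. The other half survive as `t^n`, so that the Parseval sum becomes
geometric. -/
theorem sq_pow_mul_hat_le (hW : IsRadialWeight W) {D : ℝ} (hD : 1 ≤ D)
    (hm : ∀ n, moment W n ≤ D * moment W (2 * n + 2)) {t : ℝ} (h0 : 0 ≤ t) (h1 : t < 1) (n : ℕ) :
    (t ^ n * hat W t) ^ 2 ≤ (D ^ 2 * moment W (2 * n + 1)) ^ 2 * t ^ n := by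
  have hk : t ^ (n / 2) * hat W t ≤ D ^ 2 * moment W (2 * n + 1) :=
    calc t ^ (n / 2) * hat W t ≤ moment W (n / 2) := hW.pow_mul_hat_le_moment h0 h1 _
      _ ≤ D * moment W (2 * (n / 2) + 2) := hm _
      _ ≤ D * moment W n := by
        gcongr
        exact hW.moment_antitone (by omega)
      _ ≤ D * (D * moment W (2 * n + 2)) := by
        gcongr
        exact hm n
      _ ≤ D * (D * moment W (2 * n + 1)) := by
        gcongr
        exact hW.moment_antitone (by omega)
      _ = _ := by ring
  have hh := (hW.hat_pos h0 h1).le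
  have e : t ^ n = t ^ (n / 2) * t ^ (n - n / 2) := by rw [← pow_add]; congr 1; omega
  calc (t ^ n * hat W t) ^ 2 = (t ^ (n / 2) * hat W t) ^ 2 * t ^ (2 * (n - n / 2)) := by
        rw [e]; ring
    _ ≤ (D ^ 2 * moment W (2 * n + 1)) ^ 2 * t ^ n :=
        mul_le_mul (pow_le_pow_left₀ (by positivity) hk 2)
          (pow_le_pow_of_le_one h0 h1.le (by omega)) (by positivity) (by positivity)

/-- The series on the right integrates termwise against `W`, unlike the left-hand side. The tail
from index `2 N` alone suffices when `t^N` is comparable to `1 / (2 D)`: there every moment is `≲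
hat W t` and the powers sum to `t^(2N) / (1 - t)`. -/
theorem inv_le_tsum_pow_div_moment (hW : IsRadialWeight W) {D : ℝ} (hD : 1 ≤ D)
    (hm : ∀ n, moment W n ≤ D * moment W (2 * n + 2)) {t : ℝ} (h0 : 0 ≤ t) (h1 : t < 1) :
    ((1 - t) * hat W t)⁻¹ ≤ 8 * D ^ 3 * ∑' n, t ^ n / moment W n := by
  have hh := hW.hat_pos h0 h1
  have hex : ∃ N : ℕ, t ^ N ≤ 1 / (2 * D) := by
    obtain ⟨N, hN⟩ := exists_pow_lt_of_lt_one (y := t) (show 0 < 1 / (2 * D) by positivity) h1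
    exact ⟨N, hN.le⟩
  -- `N + 1` is the first exponent at which the power falls to `1 / (2 D)`; it is not 0 because `D ≥
  -- 1`.
  obtain ⟨N, hN, hmin⟩ : ∃ N : ℕ, t ^ (N + 1) ≤ 1 / (2 * D) ∧ 1 / (2 * D) < t ^ N := by
    classical
    have hpos : Nat.find hex ≠ 0 := by
      intro h
      have := Nat.find_spec hex
      rw [h, pow_zero, le_div_iff₀ (by positivity)] at this
      linarith
    obtain ⟨M, hM⟩ := Nat.exists_eq_succ_of_ne_zero hpos
    have hspec := Nat.find_spec hex
    rw [hM] at hspec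
    refine ⟨M, hspec, ?_⟩
    exact not_le.1 (Nat.find_min hex (by omega))
  -- Splitting at `t`, the lower part is at most `t^(N+1) D ω_{2N+2} ≤ ω_{2N+2} / 2`, which is
  -- absorbed on the left.
  have h2 : moment W (2 * N + 2) ≤ 2 * hat W t := by
    have h3 := hW.moment_add_le h0 h1 (N + 1) (N + 1)
    have h4 : moment W (N + 1) ≤ D * moment W (2 * N + 2) :=
      (hm _).trans (mul_le_mul_of_nonneg_left (hW.moment_antitone (by omega)) (by linarith))
    have h5 : t ^ (N + 1) * moment W (N + 1) ≤ 1 / (2 * D) * (D * moment W (2 * N + 2)) := by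
      gcongr
      exact (hW.moment_pos _).le
    have h6 : 1 / (2 * D) * (D * moment W (2 * N + 2)) = moment W (2 * N + 2) / 2 := by
      field_simp
    rw [show N + 1 + (N + 1) = 2 * N + 2 by ring] at h3
    linarith
  have h3 : moment W (2 * N) ≤ 2 * D * hat W t :=
    calc moment W (2 * N) ≤ D * moment W (2 * (2 * N) + 2) := hm _
      _ ≤ D * moment W (2 * N + 2) := by
        gcongr
        exact hW.moment_antitone (by omega)
      _ ≤ D * (2 * hat W t) := by gcongr
      _ = _ := by ring
  have hs := hW.summable_pow_div_moment h0 h1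
  have h4 : ∑' n, t ^ (n + 2 * N) / moment W (n + 2 * N) ≤ ∑' n, t ^ n / moment W n := by
    rw [← hs.sum_add_tsum_nat_add (2 * N)]
    exact le_add_of_nonneg_left (Finset.sum_nonneg fun n _ =>
      div_nonneg (pow_nonneg h0 n) (hW.moment_pos n).le)
  have h5 : t ^ (2 * N) / (2 * D * hat W t) * (1 - t)⁻¹
      ≤ ∑' n, t ^ (n + 2 * N) / moment W (n + 2 * N) := by
    refine hasSum_le (fun n => ?_)
      ((hasSum_geometric_of_lt_one h0 h1).mul_left (t ^ (2 * N) / (2 * D * hat W t)))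
      ((summable_nat_add_iff (2 * N)).2 hs).hasSum
    rw [div_mul_eq_mul_div, ← pow_add, add_comm]
    have := hW.moment_pos (n + 2 * N)
    gcongr
    exact (hW.moment_antitone (by omega)).trans h3
  have h6 : 1 / (4 * D ^ 2) ≤ t ^ (2 * N) := by
    calc 1 / (4 * D ^ 2) = (1 / (2 * D)) ^ 2 := by field_simp; norm_num
      _ ≤ (t ^ N) ^ 2 := by gcongr
      _ = _ := by ring
  have h1t : 0 < 1 - t := by linarith
  calc ((1 - t) * hat W t)⁻¹
      = 8 * D ^ 3 * (1 / (4 * D ^ 2) / (2 * D * hat W t) * (1 - t)⁻¹) := by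
        field_simp; norm_num
    _ ≤ 8 * D ^ 3 * (t ^ (2 * N) / (2 * D * hat W t) * (1 - t)⁻¹) := by gcongr
    _ ≤ _ := by gcongr; exact h5.trans h4

/-- Half of the powers of `r` pay for `(n + 1)^β (1 - r)^β`; the rest leave the moment of order `n /
2`, and doubling returns to order `n`. -/
theorem exists_integral_rpow_le (hW : IsRadialWeight W) {D : ℝ} (hD : 1 ≤ D)
    (hm : ∀ n, moment W n ≤ D * moment W (2 * n + 2)) {β : ℝ} (hβ : 0 ≤ β) : ∃ C : ℝ, 0 < C ∧ ∀ n : ℕ,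
      ((n : ℝ) + 1) ^ β * ∫ r in (0 : ℝ)..1, (r ^ n * (1 - r) ^ β) * W r ≤ C * moment W n := by
  obtain ⟨C, hC, hb⟩ := exists_rpow_mul_pow_le hβ
  refine ⟨2 ^ β * C * D, by positivity, fun n => ?_⟩
  have hc : Continuous fun r : ℝ => (1 - r) ^ β :=
    (continuous_const.sub continuous_id).rpow_const fun _ => Or.inr hβ
  rw [← intervalIntegral.integral_const_mul]
  calc ∫ r in (0 : ℝ)..1, ((n : ℝ) + 1) ^ β * ((r ^ n * (1 - r) ^ β) * W r)
      = ∫ r in (0 : ℝ)..1, (((n : ℝ) + 1) ^ β * (r ^ n * (1 - r) ^ β)) * W r := by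
        simp only [mul_assoc]
    _ ≤ ∫ r in (0 : ℝ)..1, (2 ^ β * C * r ^ (n / 2)) * W r := by
        refine hW.integral_mul_mono (by fun_prop) (by fun_prop) le_rfl zero_le_one le_rfl
          fun r hr => ?_
        have h0 := hr.1.le
        have h1 := hr.2.le
        have h2 := hb (n / 2) r h0 h1
        have h3 : ((n : ℝ) + 1) ^ β ≤ 2 ^ β * (((n / 2 : ℕ) : ℝ) + 1) ^ β := by
          rw [← Real.mul_rpow (by norm_num) (by positivity)]
          refine Real.rpow_le_rpow (by positivity) ?_ hβ
          have : n + 1 ≤ 2 * (n / 2 + 1) := by omega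
          exact_mod_cast this
        have h4 : r ^ n ≤ r ^ (n / 2) * r ^ (n / 2) := by
          rw [← pow_add]
          exact pow_le_pow_of_le_one h0 h1 (by omega)
        have h5 : 0 ≤ (1 - r) ^ β := Real.rpow_nonneg (by linarith) _
        calc ((n : ℝ) + 1) ^ β * (r ^ n * (1 - r) ^ β)
            ≤ (2 ^ β * (((n / 2 : ℕ) : ℝ) + 1) ^ β)
              * (r ^ (n / 2) * r ^ (n / 2) * (1 - r) ^ β) := by gcongr
          _ = 2 ^ β * ((((n / 2 : ℕ) : ℝ) + 1) ^ β * (r ^ (n / 2) * (1 - r) ^ β))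
              * r ^ (n / 2) := by ring
          _ ≤ 2 ^ β * C * r ^ (n / 2) := by gcongr
    _ = 2 ^ β * C * moment W (n / 2) := by
        rw [moment, ← intervalIntegral.integral_const_mul]
        simp only [mul_assoc]
    _ ≤ 2 ^ β * C * (D * moment W (2 * (n / 2) + 2)) := by
        gcongr
        exact hm _
    _ ≤ 2 ^ β * C * (D * moment W n) := by
        gcongr
        exact hW.moment_antitone (by omega)
    _ = _ := by ring

/-- The difference carries the factor `1 - r² ≤ 2 (1 - r)`, which gains `1 / (n + 1)` by the
previous estimate with exponent 1. -/
theorem exists_moment_sub_le (hW : IsRadialWeight W) {D : ℝ} (hD : 1 ≤ D)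
    (hm : ∀ n, moment W n ≤ D * moment W (2 * n + 2)) :
    ∃ C : ℝ, 0 < C ∧ ∀ n : ℕ,
      ((n : ℝ) + 1) * (moment W (2 * n + 1) - moment W (2 * n + 3)) ≤ C * moment W (2 * n + 1) := by
  obtain ⟨C, hC, hb⟩ := hW.exists_integral_rpow_le hD hm zero_le_one
  refine ⟨2 * C, by positivity, fun n => ?_⟩
  have h1 : moment W (2 * n + 1) - moment W (2 * n + 3)
      ≤ 2 * ∫ r in (0 : ℝ)..1, (r ^ (2 * n + 1) * (1 - r) ^ (1 : ℝ)) * W r := by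
    rw [moment, moment, ← intervalIntegral.integral_sub
      (hW.intervalIntegrable_mul (continuous_pow _) (by simp) (by simp))
      (hW.intervalIntegrable_mul (continuous_pow _) (by simp) (by simp)),
      ← intervalIntegral.integral_const_mul]
    simp only [← sub_mul, ← mul_assoc, Real.rpow_one]
    refine hW.integral_mul_mono (by fun_prop) (by fun_prop) le_rfl zero_le_one le_rfl
      fun r hr => ?_
    have h0 := pow_nonneg hr.1.le (2 * n + 1)
    rw [show r ^ (2 * n + 1) - r ^ (2 * n + 3) = r ^ (2 * n + 1) * ((1 + r) * (1 - r)) by ring,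
      show 2 * r ^ (2 * n + 1) * (1 - r) = r ^ (2 * n + 1) * (2 * (1 - r)) by ring]
    have := hr.1
    have := hr.2
    gcongr
    linarith
  have h2 := hb (2 * n + 1)
  rw [Real.rpow_one] at h2
  have h3 := hW.integral_mul_nonneg (g := fun r => r ^ (2 * n + 1) * (1 - r) ^ (1 : ℝ))
    (by simp only [Real.rpow_one]; fun_prop) le_rfl zero_le_one le_rfl (fun r hr => by
      rw [Real.rpow_one]
      exact mul_nonneg (pow_nonneg hr.1.le _) (by linarith [hr.2]))
  push_cast at h2
  have h4 : (0 : ℝ) ≤ n := by positivity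
  calc ((n : ℝ) + 1) * (moment W (2 * n + 1) - moment W (2 * n + 3))
      ≤ ((n : ℝ) + 1) * (2 * ∫ r in (0 : ℝ)..1, (r ^ (2 * n + 1) * (1 - r) ^ (1 : ℝ)) * W r) := by
        gcongr
    _ ≤ 2 * ((2 * n + 1 + 1) * ∫ r in (0 : ℝ)..1, (r ^ (2 * n + 1) * (1 - r) ^ (1 : ℝ)) * W r) := by
        nlinarith
    _ ≤ _ := by linarith

end IsRadialWeight

/-! ### The weight `ω_α` and the multipliers `λ_n` for a doubling weight. -/

theorem continuous_one_sub_rpow {α : ℝ} (hα : 0 ≤ α) : Continuous fun r : ℝ => (1 - r) ^ α :=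
  (continuous_const.sub continuous_id).rpow_const fun _ => Or.inr hα

namespace IsDoublingWeight

variable {ω : ℝ → ℝ} {α : ℝ}

/-- Lower doubling leaves at least the fraction `1 - 1 / C` of the mass of `[t, 1]` on `[t, s]`, and
there `1 - r ≥ (1 - t) / K`. -/
theorem exists_le_hat_powWeight (hω : IsDoublingWeight ω) (hα : 0 < α) :
    ∃ c : ℝ, 0 < c ∧ ∀ t : ℝ, 0 ≤ t → t < 1 →
      c * (1 - t) ^ α * hat ω t ≤ hat (powWeight ω α) t := by
  obtain ⟨K, hK, C, hC, hl⟩ := hω.lower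
  have hW := hω.radialWeight
  have hK0 : 0 < K := by linarith
  have hC1 : 0 < 1 - 1 / C := by
    rw [sub_pos, div_lt_one (by linarith)]
    exact hC
  refine ⟨(1 / K) ^ α * (1 - 1 / C), by positivity, fun t h0 h1 => ?_⟩
  have h1t : 0 < 1 - t := by linarith
  set s := 1 - (1 - t) / K with hs
  have hts : t ≤ s := by
    have : (1 - t) / K ≤ 1 - t := div_le_self h1t.le hK.le
    linarith
  have hs1 : s < 1 := by
    have : 0 < (1 - t) / K := by positivity
    linarith
  have hs0 : 0 ≤ s := h0.trans hts
  have hc := continuous_one_sub_rpow hα.le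
  have e1 : hat (powWeight ω α) t
      = (∫ r in t..s, (1 - r) ^ α * ω r) + ∫ r in s..1, (1 - r) ^ α * ω r :=
    (intervalIntegral.integral_add_adjacent_intervals
      (hW.intervalIntegrable_mul hc ⟨h0, h1.le⟩ ⟨hs0, hs1.le⟩)
      (hW.intervalIntegrable_mul hc ⟨hs0, hs1.le⟩ (by simp))).symm
  have e2 : hat ω t = (∫ r in t..s, ω r) + hat ω s := by
    have := intervalIntegral.integral_add_adjacent_intervals
      (hW.intervalIntegrable_mul (g := fun _ => 1) continuous_const ⟨h0, h1.le⟩ ⟨hs0, hs1.le⟩)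
      (hW.intervalIntegrable_mul (g := fun _ => 1) continuous_const ⟨hs0, hs1.le⟩ (b := 1)
        (by simp))
    simpa [hat] using this.symm
  have h2 := hW.integral_mul_nonneg hc hs0 hs1.le le_rfl
    (fun r hr => Real.rpow_nonneg (by linarith [hr.2]) _)
  have h3 : (1 - s) ^ α * ∫ r in t..s, ω r ≤ ∫ r in t..s, (1 - r) ^ α * ω r := by
    rw [← intervalIntegral.integral_const_mul]
    refine hW.integral_mul_mono (g := fun _ => (1 - s) ^ α) continuous_const hc h0 hts hs1.le
      fun r hr => Real.rpow_le_rpow (by linarith) (by linarith [hr.2]) hα.le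
  have h4 : (1 - 1 / C) * hat ω t ≤ ∫ r in t..s, ω r := by
    have h5 := hl t ⟨h0, h1⟩
    have h6 : hat ω s ≤ 1 / C * hat ω t := by
      rw [div_mul_eq_mul_div, one_mul, le_div_iff₀ (by linarith), mul_comm]
      exact h5
    linarith
  have e3 : (1 - s) ^ α = (1 / K) ^ α * (1 - t) ^ α := by
    rw [← Real.mul_rpow (by positivity) h1t.le, hs]
    congr 1
    ring
  calc (1 / K) ^ α * (1 - 1 / C) * (1 - t) ^ α * hat ω t
      = (1 - s) ^ α * ((1 - 1 / C) * hat ω t) := by rw [e3]; ring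
    _ ≤ (1 - s) ^ α * ∫ r in t..s, ω r := by
      gcongr
    _ ≤ hat (powWeight ω α) t := by linarith

theorem isRadialWeight_powWeight (hω : IsDoublingWeight ω) (hα : 0 < α) :
    IsRadialWeight (powWeight ω α) where
  nonneg r hr := mul_nonneg (Real.rpow_nonneg (by linarith [hr.2]) _) (hω.radialWeight.nonneg r hr)
  integrable := by
    have hc := (continuous_one_sub_rpow hα.le).comp (continuous_norm.comp
      (continuous_subtype_val (p := fun z => z ∈ Metric.ball (0 : ℂ) 1)))
    refine hω.radialWeight.integrable.bdd_mul (c := 1) hc.aestronglyMeasurable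
      (Filter.Eventually.of_forall fun z => ?_)
    have hz : ‖(z : ℂ)‖ < 1 := mem_ball_zero_iff.1 z.2
    have hz0 := norm_nonneg (z : ℂ)
    change ‖(1 - ‖(z : ℂ)‖) ^ α‖ ≤ 1
    rw [Real.norm_of_nonneg (Real.rpow_nonneg (by linarith) _)]
    exact Real.rpow_le_one (by linarith) (by linarith) hα.le
  hat_ne_zero r hr := by
    obtain ⟨c, hc, h⟩ := hω.exists_le_hat_powWeight hα
    refine (lt_of_lt_of_le ?_ (h r hr.1 hr.2)).ne'
    exact mul_pos (mul_pos hc (Real.rpow_pos_of_pos (by linarith [hr.2]) _))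
      (hω.radialWeight.hat_pos hr.1 hr.2)

/-- At a point `t` with `1 - t` of order `1 / (n + 1)`, the moment of `ω` is `≲ hat ω t`, the power
`t^n` is bounded below, and the lower bound for the tail of `ω_α` applies. -/
theorem exists_le_moment_powWeight (hω : IsDoublingWeight ω) (hα : 0 < α) :
    ∃ c : ℝ, 0 < c ∧ ∀ n : ℕ,
      c * moment ω n ≤ ((n : ℝ) + 1) ^ α * moment (powWeight ω α) n := by
  have hW := hω.radialWeight
  have hV := hω.isRadialWeight_powWeight hα
  obtain ⟨D, hD, hm⟩ := hW.exists_moment_le hω.upper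
  obtain ⟨c, hc, hl⟩ := hω.exists_le_hat_powWeight hα
  set a := Real.log (2 * D) with ha
  have ha0 : 0 < a := Real.log_pos (by linarith)
  have hea : Real.exp (-a) = 1 / (2 * D) := by
    rw [Real.exp_neg, ha, Real.exp_log (by linarith), one_div]
  refine ⟨(a / (1 + a)) ^ α * (1 / (2 * D)) * c * (1 / (2 * D)), by positivity, fun n => ?_⟩
  set N : ℝ := (n : ℝ) + 1 with hN
  have hN1 : 1 ≤ N := by simp [hN]
  -- Chosen so that `t^(n+1) = 1 / (2 D)`, the value that lets half of the moment be absorbed.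
  set t := Real.exp (-(a / N)) with ht
  have h0 : 0 < t := Real.exp_pos _
  have hx : 0 < a / N := by positivity
  have h1 : t < 1 := Real.exp_lt_one_iff.2 (by linarith)
  have htN : t ^ (n + 1) = 1 / (2 * D) := by
    rw [ht, ← Real.exp_nat_mul, ← hea]
    congr 1
    push_cast
    rw [← hN]
    field_simp
  -- From `exp x ≥ 1 + x` at `x = a / N`; the resulting bound `N a / (N + a)` increases in `N ≥ 1`.
  have h1t : a / (1 + a) ≤ N * (1 - t) := by
    have h2 : t ≤ 1 / (1 + a / N) := by
      rw [ht, Real.exp_neg, ← one_div]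
      gcongr
      linarith [Real.add_one_le_exp (a / N)]
    have h3 : N * (1 - 1 / (1 + a / N)) = N * a / (N + a) := by
      have : N + a ≠ 0 := by positivity
      field_simp
      ring
    calc a / (1 + a) ≤ N * a / (N + a) := by
          rw [div_le_div_iff₀ (by positivity) (by positivity)]
          nlinarith [mul_nonneg (mul_nonneg ha0.le ha0.le) (sub_nonneg.2 hN1)]
      _ = N * (1 - 1 / (1 + a / N)) := h3.symm
      _ ≤ N * (1 - t) := by gcongr
  have hhat := hW.hat_pos h0.le h1
  have h2 : moment ω (2 * n + 2) ≤ 2 * hat ω t := by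
    have h3 := hW.moment_add_le h0.le h1 (n + 1) (n + 1)
    have h4 : moment ω (n + 1) ≤ D * moment ω (2 * n + 2) :=
      (hm _).trans (mul_le_mul_of_nonneg_left (hW.moment_antitone (by omega)) (by linarith))
    have h5 : t ^ (n + 1) * moment ω (n + 1) ≤ 1 / (2 * D) * (D * moment ω (2 * n + 2)) := by
      rw [htN]
      gcongr
    have h6 : 1 / (2 * D) * (D * moment ω (2 * n + 2)) = moment ω (2 * n + 2) / 2 := by
      field_simp
    rw [show n + 1 + (n + 1) = 2 * n + 2 by ring] at h3
    linarith
  have h3 : 1 / (2 * D) * moment ω n ≤ hat ω t := by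
    have h4 : moment ω n ≤ D * (2 * hat ω t) :=
      (hm n).trans (mul_le_mul_of_nonneg_left h2 (by linarith))
    rw [div_mul_eq_mul_div, one_mul, div_le_iff₀ (by linarith)]
    linarith
  have h4 : 1 / (2 * D) ≤ t ^ n := htN ▸ pow_le_pow_of_le_one h0.le h1.le (by omega)
  have h5 : (a / (1 + a)) ^ α ≤ N ^ α * (1 - t) ^ α := by
    rw [← Real.mul_rpow (by positivity) (by linarith)]
    exact Real.rpow_le_rpow (by positivity) h1t hα.le
  have h6 : 0 ≤ (1 - t) ^ α := Real.rpow_nonneg (by linarith) _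
  have hmn := (hW.moment_pos n).le
  calc (a / (1 + a)) ^ α * (1 / (2 * D)) * c * (1 / (2 * D)) * moment ω n
      = (a / (1 + a)) ^ α * (1 / (2 * D)) * c * (1 / (2 * D) * moment ω n) := by ring
    _ ≤ (N ^ α * (1 - t) ^ α) * t ^ n * c * hat ω t := by gcongr
    _ = N ^ α * (t ^ n * (c * (1 - t) ^ α * hat ω t)) := by ring
    _ ≤ N ^ α * (t ^ n * hat (powWeight ω α) t) := by
        gcongr
        exact hl t h0.le h1
    _ ≤ N ^ α * moment (powWeight ω α) n := by
        gcongr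
        exact hV.pow_mul_hat_le_moment h0.le h1 n

/-- The moments of `ω` and `(n + 1)^α` times those of `ω_α` are comparable in both directions, so
doubling of moments passes from `ω` to `ω_α`. -/
theorem exists_moment_powWeight_le (hω : IsDoublingWeight ω) (hα : 0 < α) :
    ∃ D : ℝ, 1 ≤ D ∧ ∀ n, moment (powWeight ω α) n ≤ D * moment (powWeight ω α) (2 * n + 2) := by
  have hW := hω.radialWeight
  have hV := hω.isRadialWeight_powWeight hα
  obtain ⟨D, hD, hm⟩ := hW.exists_moment_le hω.upper
  obtain ⟨c, hc, hl⟩ := hω.exists_le_moment_powWeight hα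
  obtain ⟨C, hC, hup⟩ := hW.exists_integral_rpow_le hD hm hα.le
  refine ⟨max 1 (C * D * c⁻¹ * 3 ^ α), le_max_left _ _, fun n => ?_⟩
  have e : ∀ n, moment (powWeight ω α) n = ∫ r in (0 : ℝ)..1, (r ^ n * (1 - r) ^ α) * ω r := by
    intro n
    simp only [moment, powWeight, mul_assoc]
  have hN : (0 : ℝ) < ((n : ℝ) + 1) ^ α := by positivity
  have h1 : ((2 * n + 2 : ℕ) + 1 : ℝ) ^ α ≤ 3 ^ α * ((n : ℝ) + 1) ^ α := by
    rw [← Real.mul_rpow (by norm_num) (by positivity)]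
    refine Real.rpow_le_rpow (by positivity) ?_ hα.le
    push_cast
    linarith [(Nat.cast_nonneg n : (0 : ℝ) ≤ n)]
  have h2 : ((n : ℝ) + 1) ^ α * moment (powWeight ω α) n
      ≤ ((n : ℝ) + 1) ^ α * (C * D * c⁻¹ * 3 ^ α * moment (powWeight ω α) (2 * n + 2)) := by
    have hp := (hV.moment_pos (2 * n + 2)).le
    calc ((n : ℝ) + 1) ^ α * moment (powWeight ω α) n ≤ C * moment ω n := by
          rw [e]
          exact hup n
      _ ≤ C * (D * moment ω (2 * n + 2)) := by
          gcongr
          exact hm n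
      _ = C * D * c⁻¹ * (c * moment ω (2 * n + 2)) := by field_simp
      _ ≤ C * D * c⁻¹ * (((2 * n + 2 : ℕ) + 1 : ℝ) ^ α * moment (powWeight ω α) (2 * n + 2)) :=
          mul_le_mul_of_nonneg_left (hl _) (by positivity)
      _ ≤ C * D * c⁻¹ * (3 ^ α * ((n : ℝ) + 1) ^ α * moment (powWeight ω α) (2 * n + 2)) := by
          gcongr
      _ = _ := by ring
  refine (le_of_mul_le_mul_left h2 hN).trans ?_
  gcongr
  · exact (hV.moment_pos _).le
  · exact le_max_right _ _

/-- The bound on the first differences of the Taylor coefficients of the derivative of the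
kernel. -/
theorem exists_abs_sub_kernelCoeff_le (hω : IsDoublingWeight ω) :
    ∃ C : ℝ, 0 < C ∧ ∀ n : ℕ,
      |((n : ℝ) + 1) * kernelCoeff ω (n + 1) - n * kernelCoeff ω n| ≤ C / moment ω (2 * n + 1) := by
  have hW := hω.radialWeight
  obtain ⟨D, hD, hm⟩ := hW.exists_moment_le hω.upper
  obtain ⟨C, hC, hs⟩ := hW.exists_moment_sub_le hD hm
  refine ⟨D / 2 + C * D / 2, by positivity, fun n => ?_⟩
  have h1 := hW.moment_pos (2 * n + 1)
  have h3 := hW.moment_pos (2 * n + 3)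
  have hle : moment ω (2 * n + 3) ≤ moment ω (2 * n + 1) := hW.moment_antitone (by omega)
  have h4 : moment ω (2 * n + 1) ≤ D * moment ω (2 * n + 3) :=
    (hm _).trans (mul_le_mul_of_nonneg_left (hW.moment_antitone (by omega)) (by linarith))
  have hs := hs n
  have hn : (0 : ℝ) ≤ n := by positivity
  rw [kernelCoeff, kernelCoeff, show 2 * (n + 1) + 1 = 2 * n + 3 by ring]
  set x := moment ω (2 * n + 1)
  set y := moment ω (2 * n + 3)
  have e : ((n : ℝ) + 1) * (2 * y)⁻¹ - n * (2 * x)⁻¹ = (x + n * (x - y)) / (2 * x * y) := by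
    field_simp
    ring
  rw [e, abs_of_nonneg (div_nonneg (add_nonneg h1.le (mul_nonneg hn (by linarith)))
    (by positivity)), div_le_div_iff₀ (by positivity) h1]
  have h5 : n * (x - y) ≤ C * x := by nlinarith
  have h6 : (x + n * (x - y)) * x ≤ (1 + C) * x * (D * y) := by
    have : x + n * (x - y) ≤ (1 + C) * x := by linarith
    gcongr
  calc (x + n * (x - y)) * x ≤ (1 + C) * x * (D * y) := h6
    _ = _ := by ring

/-- The multiplier of the fractional derivative `R^{ω,ω_α}`. -/
noncomputable def _root_.BergmanBloch.multiplier (W V : ℝ → ℝ) (n : ℕ) : ℝ :=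
  moment W (2 * n + 1) / moment V (2 * n + 1)

theorem exists_multiplier_le (hω : IsDoublingWeight ω) (hα : 0 < α) :
    ∃ C : ℝ, 0 < C ∧ ∀ n : ℕ, multiplier ω (powWeight ω α) n ≤ C * ((n : ℝ) + 1) ^ α := by
  have hV := hω.isRadialWeight_powWeight hα
  obtain ⟨c, hc, hl⟩ := hω.exists_le_moment_powWeight hα
  refine ⟨c⁻¹ * 2 ^ α, by positivity, fun n => ?_⟩
  rw [multiplier, div_le_iff₀ (hV.moment_pos _)]
  have h := hl (2 * n + 1)
  rw [show ((2 * n + 1 : ℕ) + 1 : ℝ) = 2 * ((n : ℝ) + 1) by push_cast; ring,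
    Real.mul_rpow (by norm_num) (by positivity)] at h
  calc moment ω (2 * n + 1) = c⁻¹ * (c * moment ω (2 * n + 1)) := by field_simp
    _ ≤ c⁻¹ * (2 ^ α * ((n : ℝ) + 1) ^ α * moment (powWeight ω α) (2 * n + 1)) := by gcongr
    _ = _ := by ring

/-- A discrete product rule: a difference of indices, of denominators or of numerators each costs
only a factor of order one relative to `λ`, by `exists_moment_sub_le` for both weights. -/
theorem exists_abs_sub_multiplier_le (hω : IsDoublingWeight ω) (hα : 0 < α) :
    ∃ C : ℝ, 0 < C ∧ ∀ n : ℕ,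
      |((n : ℝ) + 2) * multiplier ω (powWeight ω α) (n + 1)
        - (n + 1) * multiplier ω (powWeight ω α) n| ≤ C * ((n : ℝ) + 1) ^ α := by
  have hW := hω.radialWeight
  have hV := hω.isRadialWeight_powWeight hα
  obtain ⟨D, hD, hm⟩ := hW.exists_moment_le hω.upper
  obtain ⟨C, hC, hs⟩ := hW.exists_moment_sub_le hD hm
  obtain ⟨D', hD', hm'⟩ := hω.exists_moment_powWeight_le hα
  obtain ⟨C', hC', hs'⟩ := hV.exists_moment_sub_le hD' hm'
  obtain ⟨B, hB, hl⟩ := hω.exists_multiplier_le hα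
  refine ⟨(1 + C') * (B * 2 ^ α) + C * B, by positivity, fun n => ?_⟩
  have hl0 := hl n
  have hl1 := hl (n + 1)
  have hN : (0 : ℝ) ≤ n := by positivity
  have h2 : (((n + 1 : ℕ) : ℝ) + 1) ^ α ≤ 2 ^ α * ((n : ℝ) + 1) ^ α := by
    rw [← Real.mul_rpow (by norm_num) (by positivity)]
    refine Real.rpow_le_rpow (by positivity) ?_ hα.le
    push_cast
    linarith
  have hs := hs n
  have hs' := hs' n
  have x0 := hW.moment_pos (2 * n + 1)
  have y0 := hW.moment_pos (2 * n + 3)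
  have p0 := hV.moment_pos (2 * n + 1)
  have q0 := hV.moment_pos (2 * n + 3)
  have hyx : moment ω (2 * n + 3) ≤ moment ω (2 * n + 1) := hW.moment_antitone (by omega)
  have hqp : moment (powWeight ω α) (2 * n + 3) ≤ moment (powWeight ω α) (2 * n + 1) :=
    hV.moment_antitone (by omega)
  rw [multiplier] at hl0 hl1
  rw [multiplier, multiplier]
  rw [show 2 * (n + 1) + 1 = 2 * n + 3 by ring] at hl1 ⊢
  set x := moment ω (2 * n + 1)
  set y := moment ω (2 * n + 3)
  set p := moment (powWeight ω α) (2 * n + 1)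
  set q := moment (powWeight ω α) (2 * n + 3)
  have e : ((n : ℝ) + 2) * (y / q) - (n + 1) * (x / p)
      = y / q + (y / q) * ((n + 1) * (p - q) / p) - (n + 1) * (x - y) / p := by
    field_simp
    ring
  have h3 : (n + 1) * (p - q) / p ≤ C' := by rwa [div_le_iff₀ p0]
  have h4 : (n + 1) * (x - y) / p ≤ C * (x / p) := by
    rw [mul_div_assoc', div_le_div_iff_of_pos_right p0]
    exact hs
  have h3' : 0 ≤ (n + 1) * (p - q) / p :=
    div_nonneg (mul_nonneg (by linarith) (by linarith)) p0.le
  have h4' : 0 ≤ (n + 1) * (x - y) / p :=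
    div_nonneg (mul_nonneg (by linarith) (by linarith)) p0.le
  have hyq : 0 ≤ y / q := by positivity
  have h5 : y / q ≤ B * 2 ^ α * ((n : ℝ) + 1) ^ α := by
    rw [mul_assoc]
    exact hl1.trans (by gcongr)
  have h6 : y / q + (y / q) * ((n + 1) * (p - q) / p)
      ≤ (1 + C') * (B * 2 ^ α) * ((n : ℝ) + 1) ^ α := by
    calc y / q + (y / q) * ((n + 1) * (p - q) / p) ≤ y / q + (y / q) * C' := by gcongr
      _ = (1 + C') * (y / q) := by ring
      _ ≤ (1 + C') * (B * 2 ^ α * ((n : ℝ) + 1) ^ α) := by gcongr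
      _ = _ := by ring
  have h7 : (n + 1) * (x - y) / p ≤ C * B * ((n : ℝ) + 1) ^ α := by
    refine h4.trans ?_
    rw [mul_assoc]
    gcongr
  have h8 : 0 ≤ (1 + C') * (B * 2 ^ α) * ((n : ℝ) + 1) ^ α := by positivity
  have h9 : 0 ≤ C * B * ((n : ℝ) + 1) ^ α := by positivity
  have h10 : 0 ≤ (y / q) * ((n + 1) * (p - q) / p) := mul_nonneg hyq h3'
  rw [e, add_mul ((1 + C') * (B * 2 ^ α)), abs_le]
  constructor <;> linarith

end IsDoublingWeight

/-! ### Area measure and polar coordinates. -/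

theorem norm_coe_lt_one (z : Disk) : ‖(z : ℂ)‖ < 1 := mem_ball_zero_iff.1 z.2

theorem integrable_dA_iff {E : Type*} [NormedAddCommGroup E] {f : ℂ → E} :
    Integrable (fun ξ : Disk => f ξ) dA ↔ IntegrableOn f (Metric.ball 0 1) := by
  rw [integrableOn_iff_comap_subtypeVal Metric.isOpen_ball.measurableSet, dA,
    integrable_smul_measure (by simp [Real.pi_pos]) (by simp)]
  rfl

theorem integral_dA {E : Type*} [NormedAddCommGroup E] [NormedSpace ℝ E] (f : ℂ → E) :
    ∫ ξ : Disk, f ξ ∂dA = Real.pi⁻¹ • ∫ ξ in Metric.ball (0 : ℂ) 1, f ξ := by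
  rw [dA, integral_smul_measure, integral_subtype_comap Metric.isOpen_ball.measurableSet,
    ENNReal.toReal_ofReal (inv_nonneg.2 Real.pi_pos.le)]

theorem integrableOn_comp_polarCoord_symm {E : Type*} [NormedAddCommGroup E] [NormedSpace ℝ E]
    {f : ℂ → E} (hf : Integrable f) :
    IntegrableOn (fun p : ℝ × ℝ => p.1 • f (Complex.polarCoord.symm p)) polarCoord.target := by
  have h1 : Integrable (f ∘ Complex.measurableEquivRealProd.symm) :=
    (Complex.volume_preserving_equiv_real_prod.symm).integrable_comp_of_integrable hf
  have h2 : IntegrableOn (f ∘ Complex.measurableEquivRealProd.symm)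
      (polarCoord.symm '' polarCoord.target) := h1.integrableOn
  rw [integrableOn_image_iff_integrableOn_abs_det_fderiv_smul volume
    polarCoord.open_target.measurableSet
    (fun p _ => (hasFDerivAt_polarCoord_symm p).hasFDerivWithinAt) polarCoord.symm.injOn] at h2
  refine h2.congr_fun (fun p hp => ?_) polarCoord.open_target.measurableSet
  have hp1 : 0 < p.1 := hp.1
  simp only [det_fderivPolarCoordSymm, abs_of_pos hp1, Function.comp_apply]
  rfl

theorem integral_Ioo_polarCoord {E : Type*} [NormedAddCommGroup E] [NormedSpace ℝ E]
    (f : ℂ → E) (r : ℝ) :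
    ∫ θ in Ioo (-Real.pi) Real.pi, f (Complex.polarCoord.symm (r, θ))
      = (2 * Real.pi) • Real.circleAverage f 0 r := by
  have e : ∀ θ : ℝ, Complex.polarCoord.symm (r, θ) = circleMap 0 r θ := by
    intro θ
    simp [circleMap, Complex.exp_mul_I]
  simp only [e]
  rw [← integral_Ioc_eq_integral_Ioo, ← intervalIntegral.integral_of_le
    (by linarith [Real.pi_pos]), Real.circleAverage_eq_integral_add (-Real.pi),
    intervalIntegral.integral_comp_add_right (fun θ => f (circleMap 0 r θ)), smul_smul,
    mul_inv_cancel₀ (by positivity), one_smul]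
  congr 1 <;> ring

/-- Integration over the disk in polar coordinates. -/
theorem integral_dA_eq_circleAverage {E : Type*} [NormedAddCommGroup E] [NormedSpace ℝ E]
    [CompleteSpace E] {f : ℂ → E} (hf : Integrable (fun ξ : Disk => f ξ) dA) :
    ∫ ξ : Disk, f ξ ∂dA = ∫ r in (0 : ℝ)..1, (2 * r) • Real.circleAverage f 0 r := by
  rw [integrable_dA_iff] at hf
  set g := (Metric.ball (0 : ℂ) 1).indicator f with hg
  have hgi : Integrable g := hf.integrable_indicator Metric.isOpen_ball.measurableSet
  have hp := integrableOn_comp_polarCoord_symm hgi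
  rw [integral_dA, ← integral_indicator Metric.isOpen_ball.measurableSet,
    ← Complex.integral_comp_polarCoord_symm, ← hg]
  rw [polarCoord_target] at hp ⊢
  rw [Measure.volume_eq_prod] at hp ⊢
  rw [setIntegral_prod _ hp]
  have h1 : ∀ r ∈ Ioi (0 : ℝ), ∫ θ in Ioo (-Real.pi) Real.pi,
      r • g (Complex.polarCoord.symm (r, θ))
      = (Iio (1 : ℝ)).indicator (fun r => (2 * Real.pi * r) • Real.circleAverage f 0 r) r := by
    intro r hr
    have hr0 : 0 < r := hr
    rw [integral_smul, integral_Ioo_polarCoord, smul_smul, mul_comm r]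
    by_cases h : r < 1
    · rw [indicator_of_mem (show r ∈ Iio (1 : ℝ) from h)]
      congr 1
      refine Real.circleAverage_congr_sphere fun ξ hξ => ?_
      refine indicator_of_mem ?_ f
      have : ‖ξ‖ = r := by simpa [abs_of_pos hr0] using hξ
      simpa [this] using h
    · rw [indicator_of_notMem (show r ∉ Iio (1 : ℝ) from h)]
      have : Real.circleAverage g 0 r = 0 := by
        refine Real.circleAverage_const_on_circle fun ξ hξ => ?_
        refine indicator_of_notMem ?_ f
        have : ‖ξ‖ = r := by simpa [abs_of_pos hr0] using hξ
        simpa [this] using h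
      rw [this, smul_zero]
  rw [setIntegral_congr_fun measurableSet_Ioi h1, setIntegral_indicator measurableSet_Iio,
    Ioi_inter_Iio, intervalIntegral.integral_of_le zero_le_one, integral_Ioc_eq_integral_Ioo,
    ← integral_smul]
  refine setIntegral_congr_fun measurableSet_Ioo fun r _ => ?_
  simp only [smul_smul]
  congr 1
  field_simp

/-! ### Taylor coefficients and their recovery from integrals. -/

/-- The Taylor coefficients at the origin. -/
noncomputable def taylorCoeff (g : ℂ → ℂ) (n : ℕ) : ℂ :=
  (n.factorial : ℂ)⁻¹ * iteratedDeriv n g 0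

section Taylor

variable {g : ℂ → ℂ}

theorem hasSum_taylorCoeff (hg : DifferentiableOn ℂ g (Metric.ball 0 1)) {z : ℂ} (hz : ‖z‖ < 1) :
    HasSum (fun n => taylorCoeff g n * z ^ n) (g z) := by
  have h := Complex.hasSum_taylorSeries_on_ball hg (z := z) (by simpa using hz)
  have e : (fun n => taylorCoeff g n * z ^ n)
      = fun n => (n.factorial : ℂ)⁻¹ • (z - 0) ^ n • iteratedDeriv n g 0 := by
    ext n
    simp only [taylorCoeff, smul_eq_mul, sub_zero]
    ring
  rwa [e]

theorem summableOnDisk_taylorCoeff (hg : DifferentiableOn ℂ g (Metric.ball 0 1)) :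
    SummableOnDisk (taylorCoeff g) := fun t h0 h1 => by
  have h := (hasSum_taylorCoeff hg (z := (t : ℂ)) (by simpa [abs_of_nonneg h0] using h1)).summable
  simpa [abs_of_nonneg h0] using h.norm

theorem taylorCoeff_deriv (g : ℂ → ℂ) (n : ℕ) :
    taylorCoeff (deriv g) n = (n + 1) * taylorCoeff g (n + 1) := by
  rw [taylorCoeff, taylorCoeff, iteratedDeriv_succ', Nat.factorial_succ]
  have : ((n : ℂ) + 1) ≠ 0 := by exact_mod_cast n.succ_ne_zero
  push_cast
  field_simp

theorem circleAverage_mul_conj_pow (hg : DifferentiableOn ℂ g (Metric.ball 0 1)) {r : ℝ}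
    (h0 : 0 ≤ r) (h1 : r < 1) (n : ℕ) :
    Real.circleAverage (fun ξ => g ξ * conj ξ ^ n) 0 r = taylorCoeff g n * (r : ℂ) ^ (2 * n) := by
  rw [← circleAverage_tsum_mul_conj_pow h0 (summableOnDisk_taylorCoeff hg r h0 h1)]
  refine Real.circleAverage_congr_sphere fun ξ hξ => ?_
  have hξ' : ‖ξ‖ = r := by simpa [abs_of_nonneg h0] using hξ
  rw [(hasSum_taylorCoeff hg (hξ' ▸ h1)).tsum_eq]

/-- Both coefficients are read off from the same average over the circle of radius `1 / 2`. -/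
theorem eq_of_tsum_eq {a b : ℕ → ℂ} (ha : SummableOnDisk a) (hb : SummableOnDisk b)
    (h : ∀ z : ℂ, ‖z‖ < 1 → ∑' n, a n * z ^ n = ∑' n, b n * z ^ n) (n : ℕ) : a n = b n := by
  have h2 : (0 : ℝ) ≤ 1 / 2 := by norm_num
  have h1 := circleAverage_tsum_mul_conj_pow h2 (ha _ h2 (by norm_num)) n
  have h3 := circleAverage_tsum_mul_conj_pow h2 (hb _ h2 (by norm_num)) n
  have h4 : Real.circleAverage (fun ξ : ℂ => (∑' k, a k * ξ ^ k) * conj ξ ^ n) 0 (1 / 2)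
      = Real.circleAverage (fun ξ : ℂ => (∑' k, b k * ξ ^ k) * conj ξ ^ n) 0 (1 / 2) := by
    refine Real.circleAverage_congr_sphere fun ξ hξ => ?_
    have hξ' : ‖ξ‖ = 1 / 2 := by simpa [abs_of_nonneg h2] using hξ
    rw [h ξ (by rw [hξ']; norm_num)]
  rw [h1, h3] at h4
  exact mul_right_cancel₀ (by simp) h4

theorem taylorCoeff_eq (hg : DifferentiableOn ℂ g (Metric.ball 0 1)) {a : ℕ → ℂ}
    (ha : SummableOnDisk a) (h : ∀ z : ℂ, ‖z‖ < 1 → g z = ∑' n, a n * z ^ n) (n : ℕ) :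
    taylorCoeff g n = a n :=
  eq_of_tsum_eq (summableOnDisk_taylorCoeff hg) ha
    (fun z hz => by rw [(hasSum_taylorCoeff hg hz).tsum_eq, h z hz]) n

/-- On each circle only the `n`-th Taylor term survives. The factor `2 r` of normalized area measure
accounts for the 2 and for the odd order `2 n + 1` of the moment. -/
theorem integral_mul_conj_pow_mul (hg : DifferentiableOn ℂ g (Metric.ball 0 1)) {W : ℝ → ℝ} (n : ℕ)
    (hi : Integrable (fun ξ : Disk => g ξ * conj (ξ : ℂ) ^ n * (W ‖(ξ : ℂ)‖ : ℂ)) dA) :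
    ∫ ξ : Disk, g ξ * conj (ξ : ℂ) ^ n * (W ‖(ξ : ℂ)‖ : ℂ) ∂dA
      = 2 * taylorCoeff g n * (moment W (2 * n + 1) : ℂ) := by
  rw [integral_dA_eq_circleAverage (f := fun ξ : ℂ => g ξ * conj ξ ^ n * (W ‖ξ‖ : ℂ)) hi, moment,
    ← intervalIntegral.integral_ofReal, ← intervalIntegral.integral_const_mul,
    intervalIntegral.integral_of_le zero_le_one, intervalIntegral.integral_of_le zero_le_one,
    integral_Ioc_eq_integral_Ioo, integral_Ioc_eq_integral_Ioo]
  refine setIntegral_congr_fun measurableSet_Ioo fun r hr => ?_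
  have h1 : Real.circleAverage (fun ξ : ℂ => g ξ * conj ξ ^ n * (W ‖ξ‖ : ℂ)) 0 r
      = (W r : ℂ) • Real.circleAverage (fun ξ : ℂ => g ξ * conj ξ ^ n) 0 r := by
    rw [← Real.circleAverage_fun_smul]
    refine Real.circleAverage_congr_sphere fun ξ hξ => ?_
    have hξ' : ‖ξ‖ = r := by simpa [abs_of_nonneg hr.1.le] using hξ
    simp only [hξ', smul_eq_mul]
    ring
  simp only [h1, circleAverage_mul_conj_pow hg hr.1.le hr.2]
  rw [Complex.real_smul, smul_eq_mul]
  push_cast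
  ring

end Taylor

/-! ### Integrals against kernels of the form `F(z · conj ξ)`. -/

theorem continuous_tsum_mul_conj_pow {k : ℕ → ℂ} (hk : SummableOnDisk k) {z : ℂ} (hz : ‖z‖ < 1) :
    Continuous fun ξ : Disk => ∑' n, k n * (z * conj (ξ : ℂ)) ^ n := by
  refine (continuousOn_tsum_pow (hk ‖z‖ (norm_nonneg z) hz)).comp_continuous (by fun_prop)
    fun ξ => ?_
  have := norm_coe_lt_one ξ
  simp only [Metric.mem_closedBall, dist_zero_right, norm_mul, RCLike.norm_conj]
  exact mul_le_of_le_one_right (norm_nonneg z) this.le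

theorem norm_tsum_mul_conj_pow_le {k : ℕ → ℂ} (hk : SummableOnDisk k) {z : ℂ} (hz : ‖z‖ < 1)
    (ξ : Disk) : ‖∑' n, k n * (z * conj (ξ : ℂ)) ^ n‖ ≤ ∑' n, ‖k n‖ * ‖z‖ ^ n := by
  refine tsum_of_norm_bounded (hk ‖z‖ (norm_nonneg z) hz).hasSum fun n => ?_
  have := norm_coe_lt_one ξ
  rw [norm_mul, norm_pow, norm_mul, RCLike.norm_conj]
  gcongr
  exact mul_le_of_le_one_right (norm_nonneg z) this.le

theorem integrable_mul_tsum_mul_conj_pow {φ : Disk → ℂ} (hφ : Integrable φ dA) {k : ℕ → ℂ}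
    (hk : SummableOnDisk k) {z : ℂ} (hz : ‖z‖ < 1) :
    Integrable (fun ξ : Disk => φ ξ * ∑' n, k n * (z * conj (ξ : ℂ)) ^ n) dA :=
  hφ.mul_bdd (continuous_tsum_mul_conj_pow hk hz).aestronglyMeasurable
    (Filter.Eventually.of_forall (norm_tsum_mul_conj_pow_le hk hz))

theorem integrable_mul_conj_pow {φ : Disk → ℂ} (hφ : Integrable φ dA) (n : ℕ) :
    Integrable (fun ξ : Disk => φ ξ * conj (ξ : ℂ) ^ n) dA := by
  refine hφ.mul_bdd (c := 1) (Continuous.aestronglyMeasurable (by fun_prop))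
    (Filter.Eventually.of_forall fun ξ => ?_)
  rw [norm_pow, RCLike.norm_conj]
  exact pow_le_one₀ (norm_nonneg _) (norm_coe_lt_one ξ).le

theorem norm_integral_mul_conj_pow_le {φ : Disk → ℂ} (hφ : Integrable φ dA) (n : ℕ) :
    ∫ ξ : Disk, ‖φ ξ * conj (ξ : ℂ) ^ n‖ ∂dA ≤ ∫ ξ : Disk, ‖φ ξ‖ ∂dA := by
  refine integral_mono (integrable_mul_conj_pow hφ n).norm hφ.norm fun ξ => ?_
  simp only [norm_mul, norm_pow, RCLike.norm_conj]
  exact mul_le_of_le_one_right (norm_nonneg _) (pow_le_one₀ (norm_nonneg _) (norm_coe_lt_one ξ).le)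

/-- Expansion of an integral against a function of `z * conj ξ` into a power series in `z`. -/
theorem hasSum_integral_mul_tsum {φ : Disk → ℂ} (hφ : Integrable φ dA) {k : ℕ → ℂ}
    (hk : SummableOnDisk k) {z : ℂ} (hz : ‖z‖ < 1) :
    HasSum (fun n => k n * (∫ ξ : Disk, φ ξ * conj (ξ : ℂ) ^ n ∂dA) * z ^ n)
      (∫ ξ : Disk, φ ξ * ∑' n, k n * (z * conj (ξ : ℂ)) ^ n ∂dA) := by
  have h := hasSum_integral_of_summable_integral_norm (μ := dA)
    (F := fun (n : ℕ) (ξ : Disk) => k n * z ^ n * (φ ξ * conj (ξ : ℂ) ^ n))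
    (fun n => (integrable_mul_conj_pow hφ n).const_mul _) (by
      refine Summable.of_nonneg_of_le (fun n => integral_nonneg fun ξ => norm_nonneg _)
        (fun n => ?_) ((hk ‖z‖ (norm_nonneg z) hz).mul_right (∫ ξ : Disk, ‖φ ξ‖ ∂dA))
      simp only [norm_mul (k n * z ^ n)]
      rw [integral_const_mul, norm_mul, norm_pow]
      exact mul_le_mul_of_nonneg_left (norm_integral_mul_conj_pow_le hφ n) (by positivity))
  simp only [integral_const_mul] at h
  have e1 : (fun n => k n * (∫ ξ : Disk, φ ξ * conj (ξ : ℂ) ^ n ∂dA) * z ^ n)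
      = fun n => k n * z ^ n * ∫ ξ : Disk, φ ξ * conj (ξ : ℂ) ^ n ∂dA := by
    ext n
    ring
  have e2 : (fun ξ : Disk => φ ξ * ∑' n, k n * (z * conj (ξ : ℂ)) ^ n)
      = fun ξ : Disk => ∑' n, k n * z ^ n * (φ ξ * conj (ξ : ℂ) ^ n) := by
    ext ξ
    rw [← tsum_mul_left]
    congr 1
    ext n
    rw [mul_pow]
    ring
  rw [e1, e2]
  exact h

theorem differentiableOn_tsum_pow {a : ℕ → ℂ} (ha : SummableOnDisk a) :
    DifferentiableOn ℂ (fun z => ∑' n, a n * z ^ n) (Metric.ball 0 1) := by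
  intro z hz
  obtain ⟨t, ht, ht1⟩ := exists_between (mem_ball_zero_iff.1 hz)
  have h0 : 0 ≤ t := (norm_nonneg z).trans ht.le
  have h : DifferentiableOn ℂ (fun z => ∑' n, a n * z ^ n) (Metric.ball 0 t) := by
    refine Complex.differentiableOn_tsum_of_summable_norm (ha t h0 ht1) (fun n => by fun_prop)
      Metric.isOpen_ball fun n w hw => ?_
    have : ‖w‖ ≤ t := (mem_ball_zero_iff.1 hw).le
    rw [norm_mul, norm_pow]
    gcongr
  exact (h.differentiableAt (Metric.isOpen_ball.mem_nhds
    (mem_ball_zero_iff.2 ht))).differentiableWithinAt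

/-! ### Analytic functions as power series. -/

/-- The analytic function on the disk with given Taylor coefficients. -/
noncomputable def ofSeries (a : ℕ → ℂ) (ha : SummableOnDisk a) : Hol :=
  ⟨⟨fun z : Disk => ∑' n, a n * (z : ℂ) ^ n,
    continuousOn_iff_continuous_domRestrict.1 (differentiableOn_tsum_pow ha).continuousOn⟩,
    (differentiableOn_tsum_pow ha).congr fun z hz => by rw [extend_of_mem _ hz]; rfl⟩

theorem ofSeries_apply {a : ℕ → ℂ} (ha : SummableOnDisk a) (z : Disk) :
    ofSeries a ha z = ∑' n, a n * (z : ℂ) ^ n := rfl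

/-- The Taylor coefficients of an analytic function on the disk. -/
noncomputable def coeff (f : Hol) (n : ℕ) : ℂ := taylorCoeff (extend f) n

theorem hasSum_coeff (f : Hol) (z : Disk) : HasSum (fun n => coeff f n * (z : ℂ) ^ n) (f z) := by
  have := hasSum_taylorCoeff f.2 (norm_coe_lt_one z)
  rwa [extend_coe] at this

theorem summableOnDisk_coeff (f : Hol) : SummableOnDisk (coeff f) :=
  summableOnDisk_taylorCoeff f.2

theorem coeff_eq {f : Hol} {a : ℕ → ℂ} (ha : SummableOnDisk a)
    (h : ∀ z : Disk, f z = ∑' n, a n * (z : ℂ) ^ n) (n : ℕ) : coeff f n = a n :=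
  taylorCoeff_eq f.2 ha (fun z hz => by
    rw [extend_of_mem _ (mem_ball_zero_iff.2 hz)]
    exact h ⟨z, mem_ball_zero_iff.2 hz⟩) n

theorem coeff_ofSeries {a : ℕ → ℂ} (ha : SummableOnDisk a) (n : ℕ) :
    coeff (ofSeries a ha) n = a n := coeff_eq ha (fun _ => rfl) n

theorem hol_ext {f g : Hol} (h : ∀ z, f z = g z) : f = g := Subtype.ext (ContinuousMap.ext h)

theorem hol_ext_coeff {f g : Hol} (h : ∀ n, coeff f n = coeff g n) : f = g :=
  hol_ext fun z => (hasSum_coeff f z).unique (by simpa only [h] using hasSum_coeff g z)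

theorem summableOnDisk_mul_pow {a : ℕ → ℂ} (ha : SummableOnDisk a) {z : ℂ} (hz : ‖z‖ ≤ 1) :
    SummableOnDisk fun n => a n * z ^ n := by
  refine ha.of_norm_le (C := 1) fun n => ?_
  rw [norm_mul, norm_pow, one_mul]
  exact mul_le_of_le_one_right (norm_nonneg _) (pow_le_one₀ (norm_nonneg z) hz)

theorem summableOnDisk_single (n : ℕ) : SummableOnDisk fun k => if k = n then 1 else 0 :=
  fun t _ _ => summable_of_ne_finset_zero (s := {n}) fun k hk => by simp_all

/-- The function `z ↦ z ^ n` on the disk. -/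
noncomputable def monomial (n : ℕ) : Hol := ofSeries _ (summableOnDisk_single n)

theorem monomial_apply (n : ℕ) (z : Disk) : monomial n z = (z : ℂ) ^ n := by
  rw [monomial, ofSeries_apply, tsum_eq_single n (fun k hk => by simp [hk])]
  simp

/-! ### The Bergman kernel. -/

namespace IsRadialWeight

variable {W : ℝ → ℝ}

theorem weight_nonneg (hW : IsRadialWeight W) (ξ : Disk) : 0 ≤ W ‖(ξ : ℂ)‖ :=
  hW.nonneg _ ⟨norm_nonneg _, norm_coe_lt_one ξ⟩

theorem integrable_mul_weight (hW : IsRadialWeight W) {φ : Disk → ℂ} (hφ : AEStronglyMeasurable φ dA)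
    {C : ℝ} (hC : ∀ᵐ ξ ∂dA, ‖φ ξ‖ ≤ C) :
    Integrable (fun ξ : Disk => φ ξ * (W ‖(ξ : ℂ)‖ : ℂ)) dA :=
  hW.integrable.ofReal.bdd_mul hφ hC

/-- Because `|f| ≤ 1 + |f|²` and `W` itself is integrable. -/
theorem integrable_mul_weight_of_memA2 (hW : IsRadialWeight W) {f : Hol} (hf : MemA2 W f) :
    Integrable (fun ξ : Disk => f ξ * (W ‖(ξ : ℂ)‖ : ℂ)) dA := by
  refine (hW.integrable.add hf).mono' (f.1.continuous.aestronglyMeasurable.mul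
    hW.integrable.ofReal.aestronglyMeasurable) (Filter.Eventually.of_forall fun ξ => ?_)
  have h := hW.weight_nonneg ξ
  rw [norm_mul, Complex.norm_real, Real.norm_of_nonneg h, Pi.add_apply]
  nlinarith [sq_nonneg (‖f ξ‖ - 1 / 2)]

theorem memA2_of_bounded (hW : IsRadialWeight W) {f : Hol} {C : ℝ} (hC : ∀ ξ, ‖f ξ‖ ≤ C) :
    MemA2 W f := by
  refine hW.integrable.bdd_mul (c := C ^ 2)
    (f.1.continuous.norm.pow 2).aestronglyMeasurable (Filter.Eventually.of_forall fun ξ => ?_)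
  rw [norm_pow, norm_norm]
  exact pow_le_pow_left₀ (norm_nonneg _) (hC ξ) 2

theorem two_mul_kernelCoeff_mul (hW : IsRadialWeight W) (n : ℕ) :
    (kernelCoeff W n : ℂ) * (2 * (moment W (2 * n + 1) : ℂ)) = 1 := by
  rw [kernelCoeff]
  push_cast
  refine inv_mul_cancel₀ (mul_ne_zero two_ne_zero ?_)
  exact_mod_cast (hW.moment_pos _).ne'

theorem integral_mul_conj_pow (hW : IsRadialWeight W) {f : Hol}
    (hf : Integrable (fun ξ : Disk => f ξ * (W ‖(ξ : ℂ)‖ : ℂ)) dA) (n : ℕ) :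
    (kernelCoeff W n : ℂ) * ∫ ξ : Disk, f ξ * (W ‖(ξ : ℂ)‖ : ℂ) * conj (ξ : ℂ) ^ n ∂dA
      = coeff f n := by
  have h1 := integrable_mul_conj_pow hf n
  have e : (fun ξ : Disk => f ξ * (W ‖(ξ : ℂ)‖ : ℂ) * conj (ξ : ℂ) ^ n)
      = fun ξ : Disk => extend f ξ * conj (ξ : ℂ) ^ n * (W ‖(ξ : ℂ)‖ : ℂ) := by
    ext ξ
    rw [extend_coe]
    ring
  rw [e] at h1 ⊢
  rw [integral_mul_conj_pow_mul f.2 n h1, mul_right_comm, ← mul_assoc,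
    hW.two_mul_kernelCoeff_mul, one_mul]
  rfl

theorem summableOnDisk_kernel (hW : IsRadialWeight W) (z : Disk) :
    SummableOnDisk fun n => (kernelCoeff W n : ℂ) * conj (z : ℂ) ^ n :=
  summableOnDisk_mul_pow hW.summableOnDisk_kernelCoeff (by simpa using (norm_coe_lt_one z).le)

theorem conj_kernel (hW : IsRadialWeight W) (z ξ : Disk) :
    conj (ofSeries _ (hW.summableOnDisk_kernel z) ξ)
      = ∑' n, (kernelCoeff W n : ℂ) * ((z : ℂ) * conj (ξ : ℂ)) ^ n := by
  rw [ofSeries_apply, Complex.conj_tsum]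
  congr 1
  ext n
  simp only [map_mul, map_pow, Complex.conj_conj, Complex.conj_ofReal]
  ring

/-- For fixed `z` the series is bounded in `ξ`, hence in `A²`. Termwise integration turns the
pairing with `f` into the Taylor series of `f`. -/
theorem isBergmanKernel_ofSeries (hW : IsRadialWeight W) (z : Disk) :
    IsBergmanKernel W z (ofSeries _ (hW.summableOnDisk_kernel z)) := by
  refine ⟨hW.memA2_of_bounded (C := ∑' n, ‖(kernelCoeff W n : ℂ)‖ * ‖(z : ℂ)‖ ^ n) fun ξ => ?_,
    fun f hf => ?_⟩
  · rw [← RCLike.norm_conj, hW.conj_kernel]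
    exact norm_tsum_mul_conj_pow_le hW.summableOnDisk_kernelCoeff (norm_coe_lt_one z) ξ
  · have hi := hW.integrable_mul_weight_of_memA2 hf
    have h := hasSum_integral_mul_tsum hi hW.summableOnDisk_kernelCoeff (norm_coe_lt_one z)
    simp only [hW.integral_mul_conj_pow hi] at h
    rw [(hasSum_coeff f z).unique h]
    congr 1
    ext ξ
    rw [hW.conj_kernel]
    ring

/-- Reproducing the monomials already fixes every Taylor coefficient. This identifies the kernel
that `Classical.epsilon` selects. -/
theorem isBergmanKernel_unique (hW : IsRadialWeight W) {z : Disk} {K : Hol}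
    (hK : IsBergmanKernel W z K) : K = ofSeries _ (hW.summableOnDisk_kernel z) := by
  refine hol_ext_coeff fun n => ?_
  rw [coeff_ofSeries]
  have h := hK.2 (monomial n) (hW.memA2_of_bounded (C := 1) fun ξ => by
    rw [monomial_apply, norm_pow]
    exact pow_le_one₀ (norm_nonneg _) (norm_coe_lt_one ξ).le)
  rw [monomial_apply] at h
  rw [← hW.integral_mul_conj_pow (hW.integrable_mul_weight_of_memA2 hK.1) n, ← map_pow, h,
    ← integral_conj]
  congr 2
  ext ξ
  simp only [monomial_apply, map_mul, map_pow, Complex.conj_conj, Complex.conj_ofReal]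
  ring

theorem bergmanKernel_eq (hW : IsRadialWeight W) (z : Disk) :
    bergmanKernel W z = ofSeries _ (hW.summableOnDisk_kernel z) :=
  hW.isBergmanKernel_unique (Classical.epsilon_spec ⟨_, hW.isBergmanKernel_ofSeries z⟩)

theorem projIntegrand_eq (hW : IsRadialWeight W) (φ : Disk → ℂ) (z : Disk) :
    projIntegrand W φ z = fun ξ : Disk => φ ξ * (W ‖(ξ : ℂ)‖ : ℂ)
      * ∑' n, (kernelCoeff W n : ℂ) * ((z : ℂ) * conj (ξ : ℂ)) ^ n := by
  ext ξ
  rw [projIntegrand, hW.bergmanKernel_eq, hW.conj_kernel]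
  ring

end IsRadialWeight

/-! ### Coefficient multipliers as continuous operators. -/

theorem SummableOnDisk.mul {a b : ℕ → ℂ} (ha : SummableOnDisk a) (hb : SummableOnDisk b) :
    SummableOnDisk fun n => a n * b n := fun t h0 h1 => by
  have hs0 : 0 ≤ Real.sqrt t := Real.sqrt_nonneg t
  have hs1 : Real.sqrt t < 1 := by rw [Real.sqrt_lt' one_pos]; simpa using h1
  have h2 := hb _ hs0 hs1
  refine Summable.of_nonneg_of_le (fun n => by positivity) (fun n => ?_)
    ((ha _ hs0 hs1).mul_right (∑' n, ‖b n‖ * Real.sqrt t ^ n))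
  have h3 : ‖b n‖ * Real.sqrt t ^ n ≤ ∑' n, ‖b n‖ * Real.sqrt t ^ n :=
    h2.le_tsum n fun m _ => by positivity
  calc ‖a n * b n‖ * t ^ n = (‖a n‖ * Real.sqrt t ^ n) * (‖b n‖ * Real.sqrt t ^ n) := by
        rw [norm_mul, mul_mul_mul_comm, ← mul_pow, Real.mul_self_sqrt h0]
    _ ≤ _ := by gcongr

theorem exists_norm_le_of_isCompact {K : Set Disk} (hK : IsCompact K) :
    ∃ ρ : ℝ, 0 ≤ ρ ∧ ρ < 1 ∧ ∀ z ∈ K, ‖(z : ℂ)‖ ≤ ρ := by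
  rcases K.eq_empty_or_nonempty with rfl | hne
  · exact ⟨0, le_rfl, one_pos, by simp⟩
  · obtain ⟨z, _, hmax⟩ := hK.exists_isMaxOn hne
      (continuous_norm.comp continuous_subtype_val).continuousOn
    exact ⟨‖(z : ℂ)‖, norm_nonneg _, norm_coe_lt_one z, fun w hw => hmax hw⟩

theorem isCompact_norm_le {ρ : ℝ} (hρ : ρ < 1) : IsCompact {z : Disk | ‖(z : ℂ)‖ ≤ ρ} := by
  rw [Topology.IsEmbedding.subtypeVal.isCompact_iff]
  have : (Subtype.val '' {z : Disk | ‖(z : ℂ)‖ ≤ ρ}) = Metric.closedBall (0 : ℂ) ρ := by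
    ext z
    simp only [mem_image, mem_ofPred_eq, mem_closedBall_zero_iff]
    constructor
    · rintro ⟨w, hw, rfl⟩
      exact hw
    · intro h
      exact ⟨⟨z, mem_ball_zero_iff.2 (h.trans_lt hρ)⟩, h, rfl⟩
  rw [this]
  exact isCompact_closedBall 0 ρ

/-- The Taylor series converges in the topology of uniform convergence on compact sets. -/
theorem hasSum_coeff_smul_monomial (f : Hol) : HasSum (fun n => coeff f n • monomial n) f := by
  rw [HasSum, SummationFilter.unconditional_filter, tendsto_subtype_rng,
    ContinuousMap.tendsto_iff_forall_isCompact_tendstoUniformlyOn]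
  intro K hK
  obtain ⟨ρ, h0, h1, hρ⟩ := exists_norm_le_of_isCompact hK
  have h := tendstoUniformlyOn_tsum (f := fun n (z : Disk) => coeff f n * (z : ℂ) ^ n)
    (summableOnDisk_coeff f ρ h0 h1) (s := K) (fun n z hz => by
      rw [norm_mul, norm_pow]
      have := hρ z hz
      gcongr)
  refine (h.congr (Filter.Eventually.of_forall fun s z _ => ?_)).congr_right fun z _ => ?_
  · simp [monomial_apply]
  · exact (hasSum_coeff f z).tsum_eq

theorem norm_coeff_le (f : Hol) {ρ M : ℝ} (h0 : 0 < ρ) (h1 : ρ < 1)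
    (hM : ∀ z : Disk, ‖(z : ℂ)‖ ≤ ρ → ‖f z‖ ≤ M) (n : ℕ) : ‖coeff f n‖ ≤ M / ρ ^ n := by
  have hsub : Metric.closedBall (0 : ℂ) ρ ⊆ Metric.ball 0 1 :=
    Metric.closedBall_subset_ball h1
  have hd : DifferentiableOn ℂ (extend f) (Metric.ball 0 1) := f.2
  have h := Complex.norm_iteratedDeriv_le_of_forall_mem_sphere_norm_le n h0
    (hd.diffContOnCl_ball hsub) (C := M) (fun z hz => by
      have hz' := Metric.sphere_subset_closedBall hz
      rw [extend_of_mem _ (hsub hz')]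
      exact hM _ (mem_closedBall_zero_iff.1 hz'))
  have hn : (0 : ℝ) < n.factorial := by exact_mod_cast n.factorial_pos
  rw [coeff, taylorCoeff, norm_mul, norm_inv, Complex.norm_natCast, inv_mul_le_iff₀ hn]
  exact h.trans_eq (mul_div_assoc _ _ _)

theorem coeff_add (f g : Hol) (n : ℕ) : coeff (f + g) n = coeff f n + coeff g n := by
  refine coeff_eq (a := fun n => coeff f n + coeff g n) (fun t h0 h1 => ?_) (fun z => ?_) n
  · refine Summable.of_nonneg_of_le (fun n => by positivity) (fun n => ?_)
      ((summableOnDisk_coeff f t h0 h1).add (summableOnDisk_coeff g t h0 h1))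
    rw [← add_mul]
    gcongr
    exact norm_add_le _ _
  · simp only [add_mul]
    exact (((hasSum_coeff f z).add (hasSum_coeff g z)).tsum_eq).symm

theorem coeff_smul (c : ℂ) (f : Hol) (n : ℕ) : coeff (c • f) n = c * coeff f n := by
  refine coeff_eq (a := fun n => c * coeff f n)
    ((summableOnDisk_coeff f).of_norm_le (C := ‖c‖) fun n => (norm_mul _ _).le) (fun z => ?_) n
  simp only [mul_assoc]
  exact (((hasSum_coeff f z).mul_left c).tsum_eq).symm

/-- The coefficient multiplier operator on analytic functions. -/
noncomputable def multiplierLinearMap (l : ℕ → ℂ) (hl : SummableOnDisk l) : Hol →ₗ[ℂ] Hol where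
  toFun f := ofSeries _ (hl.mul (summableOnDisk_coeff f))
  map_add' f g := hol_ext_coeff fun n => by
    simp only [coeff_add, coeff_ofSeries, mul_add]
  map_smul' c f := hol_ext_coeff fun n => by
    simp only [coeff_smul, coeff_ofSeries, RingHom.id_apply]
    ring

theorem coeff_multiplierLinearMap {l : ℕ → ℂ} (hl : SummableOnDisk l) (f : Hol) (n : ℕ) :
    coeff (multiplierLinearMap l hl f) n = l n * coeff f n :=
  coeff_ofSeries (hl.mul (summableOnDisk_coeff f)) n

/-- Cauchy estimates at radius `s` lose a factor `(ρ / s)^n` that sums against the multipliers; this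
is the estimate behind continuity for the compact-open topology. -/
theorem norm_multiplierLinearMap_le {l : ℕ → ℂ} (hl : SummableOnDisk l) {ρ s M : ℝ} (h0 : 0 ≤ ρ)
    (hρs : ρ < s) (hs : s < 1) {f : Hol} (hM : ∀ z : Disk, ‖(z : ℂ)‖ ≤ s → ‖f z‖ ≤ M)
    {z : Disk} (hz : ‖(z : ℂ)‖ ≤ ρ) :
    ‖multiplierLinearMap l hl f z‖ ≤ (∑' n, ‖l n‖ * (ρ / s) ^ n) * M := by
  have hs0 : 0 < s := h0.trans_lt hρs
  have hsum := hl (ρ / s) (by positivity) (by rwa [div_lt_one hs0])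
  have h := hasSum_coeff (multiplierLinearMap l hl f) z
  rw [← h.tsum_eq]
  refine tsum_of_norm_bounded (hsum.hasSum.mul_right M) fun n => ?_
  rw [coeff_multiplierLinearMap, norm_mul, norm_mul, norm_pow]
  calc ‖l n‖ * ‖coeff f n‖ * ‖(z : ℂ)‖ ^ n ≤ ‖l n‖ * (M / s ^ n) * ρ ^ n := by
        have h1 := norm_coeff_le f hs0 hs hM n
        have h2 : 0 ≤ M / s ^ n := (norm_nonneg _).trans h1
        gcongr
    _ = ‖l n‖ * (ρ / s) ^ n * M := by
        rw [div_pow]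
        ring

theorem continuous_multiplierLinearMap {l : ℕ → ℂ} (hl : SummableOnDisk l) :
    Continuous (multiplierLinearMap l hl) := by
  refine continuous_iff_continuousAt.2 fun f₀ => ?_
  rw [ContinuousAt, tendsto_subtype_rng,
    ContinuousMap.tendsto_iff_forall_isCompact_tendstoUniformlyOn]
  intro K hK
  obtain ⟨ρ, h0, h1, hρ⟩ := exists_norm_le_of_isCompact hK
  obtain ⟨s, hρs, hs⟩ := exists_between h1
  have hid : Filter.Tendsto (fun f : Hol => (f : C(Disk, ℂ))) (nhds f₀) (nhds f₀.1) :=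
    continuous_subtype_val.continuousAt
  rw [ContinuousMap.tendsto_iff_forall_isCompact_tendstoUniformlyOn] at hid
  have hu := hid _ (isCompact_norm_le hs)
  rw [Metric.tendstoUniformlyOn_iff] at hu ⊢
  intro ε hε
  set S := ∑' n, ‖l n‖ * (ρ / s) ^ n with hS
  have hS0 : 0 ≤ S := tsum_nonneg fun n => by
    have : 0 < s := h0.trans_lt hρs
    positivity
  filter_upwards [hu (ε / (S + 1)) (by positivity)] with f hf z hz
  have e : ∀ (g₀ g : Hol) (z : Disk), (g₀ + (-1 : ℂ) • g) z = g₀ z - g z := fun g₀ g z => by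
    change g₀ z + (-1 : ℂ) * g z = _
    ring
  have h2 := norm_multiplierLinearMap_le hl h0 hρs hs (f := f₀ + (-1 : ℂ) • f) (M := ε / (S + 1))
    (fun z hz => by
      have := hf z hz
      rw [dist_eq_norm] at this
      rw [e]
      exact this.le) (hρ z hz)
  rw [map_add, map_smul, e] at h2
  rw [dist_eq_norm]
  refine lt_of_le_of_lt h2 ?_
  rw [← hS, mul_div_assoc', div_lt_iff₀ (by positivity)]
  nlinarith

/-- The coefficient multiplier operator as a continuous operator. -/
noncomputable def multiplierCLM (l : ℕ → ℂ) (hl : SummableOnDisk l) : Hol →L[ℂ] Hol :=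
  ⟨multiplierLinearMap l hl, continuous_multiplierLinearMap hl⟩

theorem coeff_multiplierCLM {l : ℕ → ℂ} (hl : SummableOnDisk l) (f : Hol) (n : ℕ) :
    coeff (multiplierCLM l hl f) n = l n * coeff f n := coeff_multiplierLinearMap hl f n

theorem coeff_dilate (r : Ioo (0 : ℝ) 1) (f : Hol) (n : ℕ) :
    coeff (dilate r f) n = ((r : ℝ) : ℂ) ^ n * coeff f n := by
  refine coeff_eq (a := fun n => ((r : ℝ) : ℂ) ^ n * coeff f n) ?_ (fun z => ?_) n
  · simp only [mul_comm _ (coeff f _)]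
    refine summableOnDisk_mul_pow (summableOnDisk_coeff f) ?_
    rw [Complex.norm_real, Real.norm_of_nonneg r.2.1.le]
    exact r.2.2.le
  · have h := (hasSum_coeff f (scale r z)).tsum_eq
    change f (scale r z) = _
    rw [← h]
    congr 1
    ext n
    change coeff f n * (((r : ℝ) : ℂ) * (z : ℂ)) ^ n = _
    ring

/-! ### The fractional derivative as a coefficient multiplier. -/

section FracDeriv

variable {W V : ℝ → ℝ}

theorem multiplier_nonneg (hW : IsRadialWeight W) (hV : IsRadialWeight V) (n : ℕ) :
    0 ≤ multiplier W V n := div_nonneg (hW.moment_pos _).le (hV.moment_pos _).le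

theorem summableOnDisk_multiplier (hW : IsRadialWeight W) (hV : IsRadialWeight V) :
    SummableOnDisk fun n => (multiplier W V n : ℂ) := by
  refine hV.summableOnDisk_kernelCoeff.of_norm_le (C := 2 * moment W 0) fun n => ?_
  rw [Complex.norm_real, Complex.norm_real, Real.norm_of_nonneg (multiplier_nonneg hW hV n),
    Real.norm_of_nonneg (hV.kernelCoeff_pos n).le, multiplier, kernelCoeff, mul_inv, mul_mul_mul_comm,
    mul_inv_cancel₀ two_ne_zero, one_mul, div_eq_mul_inv]
  have := hV.moment_pos (2 * n + 1)
  gcongr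
  exact hW.moment_antitone (Nat.zero_le _)

theorem multiplier_mul_kernelCoeff (hW : IsRadialWeight W) (n : ℕ) :
    (multiplier W V n : ℂ) * kernelCoeff W n = kernelCoeff V n := by
  rw [← Complex.ofReal_mul, multiplier, kernelCoeff, kernelCoeff]
  congr 1
  have := hW.moment_pos (2 * n + 1)
  field_simp

theorem isFracDeriv_multiplier (hW : IsRadialWeight W) (hV : IsRadialWeight V) :
    IsFracDeriv W V (multiplierCLM _ (summableOnDisk_multiplier hW hV)) where
  dilate_comm r f := hol_ext_coeff fun n => by
    rw [coeff_dilate, coeff_multiplierCLM, coeff_multiplierCLM, coeff_dilate]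
    ring
  map_kernel z := hol_ext_coeff fun n => by
    rw [coeff_multiplierCLM, hW.bergmanKernel_eq, hV.bergmanKernel_eq, coeff_ofSeries,
      coeff_ofSeries, ← mul_assoc, multiplier_mul_kernelCoeff hW]

/-- Evaluation at a point of the disk. -/
noncomputable def evalAt (ξ : Disk) : Hol →L[ℂ] ℂ := (ContinuousMap.evalCLM ℂ ξ).comp Hol.subtypeL

theorem evalAt_apply (ξ : Disk) (f : Hol) : evalAt ξ f = f ξ := rfl

theorem hasSum_map_apply (R : Hol →L[ℂ] Hol) (f : Hol) (ξ : Disk) :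
    HasSum (fun n => coeff f n * R (monomial n) ξ) (R f ξ) := by
  have h := ((evalAt ξ).comp R).hasSum (hasSum_coeff_smul_monomial f)
  simpa only [ContinuousLinearMap.comp_apply, map_smul, evalAt_apply, smul_eq_mul] using h

/-- For fixed `ξ`, the relation between the kernels is an identity of power series in `conj z`, by
continuity of `R`; comparing coefficients determines `R` on monomials. -/
theorem IsFracDeriv.map_monomial (hW : IsRadialWeight W) (hV : IsRadialWeight V)
    {R : Hol →L[ℂ] Hol} (hR : IsFracDeriv W V R) (n : ℕ) (ξ : Disk) :
    R (monomial n) ξ = multiplier W V n * (ξ : ℂ) ^ n := by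
  have hs : ∀ w : ℂ, ‖w‖ < 1 → HasSum (fun n => kernelCoeff W n * R (monomial n) ξ * w ^ n)
      (∑' n, kernelCoeff V n * (ξ : ℂ) ^ n * w ^ n) := by
    intro w hw
    set z : Disk := ⟨conj w, by simpa using hw⟩ with hz
    have h := hasSum_map_apply R (bergmanKernel W z) ξ
    have hcz : conj (z : ℂ) = w := by simp [hz]
    rw [hR.map_kernel, hV.bergmanKernel_eq, ofSeries_apply, hW.bergmanKernel_eq] at h
    simp only [coeff_ofSeries, hcz] at h
    simpa only [mul_right_comm] using h
  have h := eq_of_tsum_eq (a := fun n => kernelCoeff W n * R (monomial n) ξ)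
    (b := fun n => kernelCoeff V n * (ξ : ℂ) ^ n) (fun t h0 h1 => by
      have := (hs t (by simpa [abs_of_nonneg h0] using h1)).summable.norm
      simpa [abs_of_nonneg h0] using this)
    (summableOnDisk_mul_pow hV.summableOnDisk_kernelCoeff (norm_coe_lt_one ξ).le)
    (fun w hw => (hs w hw).tsum_eq) n
  have hne : (kernelCoeff W n : ℂ) ≠ 0 := by exact_mod_cast (hW.kernelCoeff_pos n).ne'
  refine mul_left_cancel₀ hne ?_
  rw [h, ← multiplier_mul_kernelCoeff hW]
  ring

/-- The explicit multiplier shows that the operator chosen by `Classical.epsilon` has the defining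
properties; its values on monomials and continuity then determine it. -/
theorem coeff_fracDeriv (hW : IsRadialWeight W) (hV : IsRadialWeight V) (f : Hol) (n : ℕ) :
    coeff (fracDeriv W V f) n = multiplier W V n * coeff f n := by
  have hR : IsFracDeriv W V (fracDeriv W V) :=
    Classical.epsilon_spec ⟨_, isFracDeriv_multiplier hW hV⟩
  refine coeff_eq (a := fun n => multiplier W V n * coeff f n)
    ((summableOnDisk_multiplier hW hV).mul (summableOnDisk_coeff f)) (fun z => ?_) n
  rw [← (hasSum_map_apply (fracDeriv W V) f z).tsum_eq]
  congr 1
  ext n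
  rw [hR.map_monomial hW hV]
  ring

end FracDeriv

/-! ### Area integrals of the two kernels. -/

/-- A weighted area integral of `‖F(z conj ξ)‖` is bounded through the circular means of `F`. -/
theorem integral_norm_tsum_le {a : ℕ → ℝ} (ha : SummableOnDisk fun n => (a n : ℂ)) {W : ℝ → ℝ}
    (hW0 : ∀ r ∈ Ico (0 : ℝ) 1, 0 ≤ W r) (hWi : Integrable (fun ξ : Disk => W ‖(ξ : ℂ)‖) dA)
    {z : ℂ} (hz : ‖z‖ < 1) {H : ℝ → ℝ} (hH : IntervalIntegrable H volume 0 1)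
    (h : ∀ r ∈ Ioo (0 : ℝ) 1, 2 * r * (W r *
      Real.circleAverage (fun ξ : ℂ => ‖∑' n, (a n : ℂ) * (conj z * ξ) ^ n‖) 0 r) ≤ H r) :
    ∫ ξ : Disk, ‖∑' n, (a n : ℂ) * (z * conj (ξ : ℂ)) ^ n‖ * W ‖(ξ : ℂ)‖ ∂dA
      ≤ ∫ r in (0 : ℝ)..1, H r := by
  have hi : Integrable
      (fun ξ : Disk => ‖∑' n, (a n : ℂ) * (z * conj (ξ : ℂ)) ^ n‖ * W ‖(ξ : ℂ)‖) dA := by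
    refine hWi.bdd_mul (c := ∑' n, ‖(a n : ℂ)‖ * ‖z‖ ^ n)
      (continuous_tsum_mul_conj_pow ha hz).norm.aestronglyMeasurable
      (Filter.Eventually.of_forall fun ξ => ?_)
    rw [norm_norm]
    exact norm_tsum_mul_conj_pow_le ha hz ξ
  -- The coefficients are real, so conjugation makes the series analytic in `ξ` without changing its
  -- modulus.
  have hc : ∀ ξ : ℂ, ‖∑' n, (a n : ℂ) * (z * conj ξ) ^ n‖
      = ‖∑' n, (a n : ℂ) * (conj z * ξ) ^ n‖ := by
    intro ξ
    rw [← RCLike.norm_conj, Complex.conj_tsum]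
    simp only [map_mul, map_pow, Complex.conj_conj, Complex.conj_ofReal]
  rw [integral_dA_eq_circleAverage
    (f := fun ξ : ℂ => ‖∑' n, (a n : ℂ) * (z * conj ξ) ^ n‖ * W ‖ξ‖) hi,
    intervalIntegral.integral_of_le zero_le_one, intervalIntegral.integral_of_le zero_le_one,
    integral_Ioc_eq_integral_Ioo, integral_Ioc_eq_integral_Ioo]
  have e : ∀ r ∈ Ioo (0 : ℝ) 1, Real.circleAverage
      (fun ξ : ℂ => ‖∑' n, (a n : ℂ) * (z * conj ξ) ^ n‖ * W ‖ξ‖) 0 r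
      = W r * Real.circleAverage (fun ξ : ℂ => ‖∑' n, (a n : ℂ) * (conj z * ξ) ^ n‖) 0 r := by
    intro r hr
    rw [← smul_eq_mul, ← Real.circleAverage_fun_smul]
    refine Real.circleAverage_congr_sphere fun ξ hξ => ?_
    have hξ' : ‖ξ‖ = r := by simpa [abs_of_nonneg hr.1.le] using hξ
    simp only [hξ', smul_eq_mul, hc]
    ring
  refine integral_mono_of_nonneg ?_
    ((intervalIntegrable_iff_integrableOn_Ioo_of_le zero_le_one).1 hH) ?_
  · refine (ae_restrict_iff' measurableSet_Ioo).2 (Filter.Eventually.of_forall fun r hr => ?_)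
    simp only [Pi.zero_apply, e r hr, smul_eq_mul]
    refine mul_nonneg (by linarith [hr.1]) (mul_nonneg (hW0 r ⟨hr.1.le, hr.2⟩) ?_)
    exact Real.circleAverage_nonneg_of_nonneg fun ξ _ => norm_nonneg _
  · refine (ae_restrict_iff' measurableSet_Ioo).2 (Filter.Eventually.of_forall fun r hr => ?_)
    simp only [e r hr, smul_eq_mul]
    exact h r hr

/-- Integrating `r^n W` produces exactly the moment in the denominator, so a geometric series
remains. -/
theorem IsRadialWeight.intervalIntegral_tsum {W : ℝ → ℝ} (hW : IsRadialWeight W) {ρ : ℝ}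
    (h0 : 0 ≤ ρ) (h1 : ρ < 1) :
    IntervalIntegrable (fun r => (∑' n, (ρ * r) ^ n / moment W n) * W r) volume 0 1 ∧
      ∫ r in (0 : ℝ)..1, (∑' n, (ρ * r) ^ n / moment W n) * W r = (1 - ρ)⁻¹ := by
  have hs := hW.summable_pow_div_moment h0 h1
  have hm := fun n => hW.moment_pos n
  have hle : ∀ n, ∀ r ∈ Icc (0 : ℝ) 1, (ρ * r) ^ n / moment W n ≤ ρ ^ n / moment W n := by
    intro n r hr
    have := hm n
    have := hr.1
    gcongr
    exact mul_le_of_le_one_right h0 hr.2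
  have hn : ∀ n, ∀ r ∈ Icc (0 : ℝ) 1, 0 ≤ (ρ * r) ^ n / moment W n := fun n r hr =>
    div_nonneg (pow_nonneg (mul_nonneg h0 hr.1) n) (hm n).le
  have hc : ContinuousOn (fun r => ∑' n, (ρ * r) ^ n / moment W n) (Icc 0 1) := by
    refine continuousOn_tsum (fun n => by fun_prop) hs fun n r hr => ?_
    rw [Real.norm_of_nonneg (hn n r hr)]
    exact hle n r hr
  refine ⟨hW.intervalIntegrable.continuousOn_mul (by rwa [uIcc_of_le zero_le_one]), ?_⟩
  have h := intervalIntegral.hasSum_integral_of_dominated_convergence (a := 0) (b := 1)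
    (μ := volume) (F := fun n r => (ρ * r) ^ n / moment W n * W r)
    (f := fun r => (∑' n, (ρ * r) ^ n / moment W n) * W r)
    (fun n r => ρ ^ n / moment W n * |W r|)
    (fun n => ?_) (fun n => ?_) ?_ ?_ ?_
  · have e : ∀ n, ∫ r in (0 : ℝ)..1, (ρ * r) ^ n / moment W n * W r = ρ ^ n := by
      intro n
      have e2 : ∀ r : ℝ, (ρ * r) ^ n / moment W n * W r = ρ ^ n / moment W n * (r ^ n * W r) := by
        intro r
        ring
      simp only [e2, intervalIntegral.integral_const_mul]
      exact div_mul_cancel₀ _ (hm n).ne'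
    simp only [e] at h
    exact h.unique (hasSum_geometric_of_lt_one h0 h1)
  · have : Continuous fun r : ℝ => (ρ * r) ^ n / moment W n := by fun_prop
    have h2 := (hW.intervalIntegrable_mul this (a := 0) (b := 1) (by simp) (by simp)).def'
    exact h2.aestronglyMeasurable
  · refine Filter.Eventually.of_forall fun r hr => ?_
    rw [uIoc_of_le zero_le_one] at hr
    rw [norm_mul, Real.norm_eq_abs (W r), Real.norm_of_nonneg (hn n r ⟨hr.1.le, hr.2⟩)]
    exact mul_le_mul_of_nonneg_right (hle n r ⟨hr.1.le, hr.2⟩) (abs_nonneg _)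
  · exact Filter.Eventually.of_forall fun r _ => hs.mul_right _
  · simp only [tsum_mul_right]
    exact hW.intervalIntegrable.abs.const_mul _
  · refine Filter.Eventually.of_forall fun r hr => ?_
    rw [uIoc_of_le zero_le_one] at hr
    refine HasSum.mul_right _ (Summable.hasSum ?_)
    exact Summable.of_nonneg_of_le (fun n => hn n r ⟨hr.1.le, hr.2⟩)
      (fun n => hle n r ⟨hr.1.le, hr.2⟩) hs

variable {ω : ℝ → ℝ} {α : ℝ}

/-- The Taylor coefficients of the derivative of the Bergman kernel. -/
noncomputable def derivKernelCoeff (ω : ℝ → ℝ) (n : ℕ) : ℝ := ((n : ℝ) + 1) * kernelCoeff ω (n + 1)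

/-- The coefficients of the kernel that represents the fractional derivative of a Bloch function
through its derivative. -/
noncomputable def fracKernelCoeff (ω : ℝ → ℝ) (α : ℝ) (n : ℕ) : ℝ :=
  ((n : ℝ) + 2) * multiplier ω (powWeight ω α) (n + 1)

theorem IsRadialWeight.summableOnDisk_derivKernelCoeff (hω : IsRadialWeight ω) :
    SummableOnDisk fun n => (derivKernelCoeff ω n : ℂ) := by
  refine hω.summableOnDisk_kernelCoeff.shift.of_norm_le_rpow (C := 1) zero_le_one fun n => ?_
  rw [derivKernelCoeff, one_mul, Real.rpow_one, Complex.ofReal_mul, norm_mul, Complex.norm_real,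
    Real.norm_of_nonneg (by positivity)]

/-- The weighted integral of the derivative of the Bergman kernel. -/
theorem IsDoublingWeight.exists_integral_derivKernel_le (hω : IsDoublingWeight ω) :
    ∃ C : ℝ, 0 < C ∧ ∀ z : ℂ, ‖z‖ < 1 →
      ∫ ξ : Disk, ‖∑' n, (derivKernelCoeff ω n : ℂ)
        * (z * conj (ξ : ℂ)) ^ n‖ * ω ‖(ξ : ℂ)‖ ∂dA ≤ C / (1 - ‖z‖) := by
  have hW := hω.radialWeight
  obtain ⟨D, hD, hm⟩ := hW.exists_moment_le hω.upper
  obtain ⟨C, hC, hd⟩ := hω.exists_abs_sub_kernelCoeff_le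
  refine ⟨2 * (C * D ^ 2 * (8 * D ^ 3)), by positivity, fun z hz => ?_⟩
  have ha := hW.summableOnDisk_derivKernelCoeff
  obtain ⟨hint, hval⟩ := hW.intervalIntegral_tsum (norm_nonneg z) hz
  refine (integral_norm_tsum_le ha hW.nonneg hW.integrable hz
    (H := fun r => 2 * (C * D ^ 2 * (8 * D ^ 3)) *
      ((∑' n, (‖z‖ * r) ^ n / moment ω n) * ω r)) (hint.const_mul _) fun r hr => ?_).trans_eq ?_
  · have hz' : ‖conj z‖ = ‖z‖ := RCLike.norm_conj z
    have hr0 := hr.1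
    have ht0 : 0 ≤ ‖z‖ * r := by positivity
    have ht1 : ‖z‖ * r < 1 := (mul_le_of_le_one_right (norm_nonneg z) hr.2.le).trans_lt hz
    have hh := hW.hat_pos ht0 ht1
    -- The value 0 at index -1 fits the formula, since `n · kernelCoeff ω n` vanishes at `n = 0`.
    have hd' : ∀ n, ‖firstDiff (fun n => (derivKernelCoeff ω n : ℂ)) n‖
        ≤ C / moment ω (2 * n + 1) := by
      intro n
      refine le_trans (le_of_eq ?_) (hd n)
      cases n with
      | zero => simp [firstDiff, derivKernelCoeff]
      | succ n =>
        simp only [firstDiff, derivKernelCoeff]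
        rw [← Complex.ofReal_sub, Complex.norm_real, Real.norm_eq_abs]
        push_cast
        rfl
    have hQ : 0 < C * D ^ 2 / hat ω (‖z‖ * r) := by positivity
    have h1 := circleAverage_norm_tsum_le
      (a := fun n => (derivKernelCoeff ω n : ℂ)) (z := conj z) hr0.le
      (by rwa [hz']) (by rw [hz']; exact ha _ ht0 ht1) hQ (fun n => by
        rw [hz']
        have h2 := hW.sq_pow_mul_hat_le hD hm ht0 ht1 n
        have h3 := hW.moment_pos (2 * n + 1)
        calc _ ≤ (C / moment ω (2 * n + 1) * (‖z‖ * r) ^ n) ^ 2 := by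
              gcongr
              exact hd' n
          _ = (C / (moment ω (2 * n + 1) * hat ω (‖z‖ * r))) ^ 2
              * ((‖z‖ * r) ^ n * hat ω (‖z‖ * r)) ^ 2 := by field_simp
          _ ≤ (C / (moment ω (2 * n + 1) * hat ω (‖z‖ * r))) ^ 2
              * ((D ^ 2 * moment ω (2 * n + 1)) ^ 2 * (‖z‖ * r) ^ n) := by gcongr
          _ = _ := by field_simp)
    rw [hz'] at h1
    have h2 := hW.inv_le_tsum_pow_div_moment hD hm ht0 ht1
    have h3 := h1.trans (calc
      C * D ^ 2 / hat ω (‖z‖ * r) / (1 - ‖z‖ * r)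
        = C * D ^ 2 * ((1 - ‖z‖ * r) * hat ω (‖z‖ * r))⁻¹ := by
          rw [div_div, div_eq_mul_inv, mul_comm (hat ω _)]
      _ ≤ C * D ^ 2 * (8 * D ^ 3 * ∑' n, (‖z‖ * r) ^ n / moment ω n) :=
        mul_le_mul_of_nonneg_left h2 (by positivity))
    have hw := hW.nonneg r ⟨hr0.le, hr.2⟩
    have hS : 0 ≤ ∑' n, (‖z‖ * r) ^ n / moment ω n := tsum_nonneg fun n =>
      div_nonneg (pow_nonneg ht0 n) (hW.moment_pos n).le
    calc _ ≤ 2 * 1 * (ω r * (C * D ^ 2 * (8 * D ^ 3 * ∑' n, (‖z‖ * r) ^ n / moment ω n))) := by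
          have := hr.2.le
          gcongr
          exact mul_nonneg hw (Real.circleAverage_nonneg_of_nonneg fun ξ _ => norm_nonneg _)
      _ = _ := by ring
  · rw [intervalIntegral.integral_const_mul, hval, div_eq_mul_inv]

theorem summableOnDisk_fracKernelCoeff (hω : IsDoublingWeight ω) (hα : 0 < α) :
    SummableOnDisk fun n =>
      (fracKernelCoeff ω α n : ℂ) := by
  have h := summableOnDisk_multiplier hω.radialWeight (hω.isRadialWeight_powWeight hα)
  refine h.shift.of_norm_le_rpow (C := 2) zero_le_one fun n => ?_
  rw [fracKernelCoeff, Real.rpow_one, Complex.ofReal_mul, norm_mul, Complex.norm_real,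
    Real.norm_of_nonneg (by positivity)]
  gcongr
  linarith [(Nat.cast_nonneg n : (0 : ℝ) ≤ n)]

theorem integral_rpow_neg_le (hα : 0 < α) {δ : ℝ} (hδ : 0 < δ) :
    IntervalIntegrable (fun r : ℝ => (1 - r + δ) ^ (-α - 1)) volume 0 1 ∧
      ∫ r in (0 : ℝ)..1, (1 - r + δ) ^ (-α - 1) ≤ δ ^ (-α) / α := by
  have hpos : ∀ r ∈ uIcc (0 : ℝ) 1, 0 < 1 - r + δ := by
    intro r hr
    rw [uIcc_of_le zero_le_one] at hr
    linarith [hr.2]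
  have hi : IntervalIntegrable (fun r : ℝ => (1 - r + δ) ^ (-α - 1)) volume 0 1 := by
    refine ContinuousOn.intervalIntegrable ?_
    refine ContinuousOn.rpow_const (by fun_prop) fun r hr => Or.inl (hpos r hr).ne'
  refine ⟨hi, ?_⟩
  have hd : ∀ r ∈ uIcc (0 : ℝ) 1,
      HasDerivAt (fun r : ℝ => (1 - r + δ) ^ (-α) / α) ((1 - r + δ) ^ (-α - 1)) r := by
    intro r hr
    have h1 : HasDerivAt (fun r : ℝ => 1 - r + δ) (-1) r := by
      simpa using ((hasDerivAt_id r).const_sub 1).add_const δ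
    have h2 := (h1.rpow_const (p := -α) (Or.inl (hpos r hr).ne')).div_const α
    rwa [show -1 * -α * (1 - r + δ) ^ (-α - 1) / α = (1 - r + δ) ^ (-α - 1) by
      field_simp] at h2
  rw [intervalIntegral.integral_eq_sub_of_hasDerivAt hd hi]
  have : 0 ≤ (1 - 0 + δ) ^ (-α) / α := by positivity
  simp only [sub_self, zero_add]
  linarith

theorem isFiniteMeasure_dA : IsFiniteMeasure dA := by
  have h : Integrable (fun _ : Disk => (1 : ℝ)) dA :=
    (integrable_dA_iff (f := fun _ : ℂ => (1 : ℝ))).2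
      (integrableOn_const Metric.isBounded_ball.measure_lt_top.ne)
  exact (integrable_const_iff_isFiniteMeasure one_ne_zero).1 h

/-- The area integral of the kernel of the fractional derivative of a Bloch function. -/
theorem IsDoublingWeight.exists_integral_fracKernel_le (hω : IsDoublingWeight ω) (hα : 0 < α) :
    ∃ C : ℝ, 0 < C ∧ ∀ z : ℂ, ‖z‖ < 1 →
      ∫ ξ : Disk, ‖∑' n, (fracKernelCoeff ω α n : ℂ)
        * (z * conj (ξ : ℂ)) ^ n‖ ∂dA ≤ C * (1 - ‖z‖) ^ (-α) := by
  have hW := hω.radialWeight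
  have hV := hω.isRadialWeight_powWeight hα
  have ha := summableOnDisk_fracKernelCoeff hω hα
  obtain ⟨B, hB, hb⟩ := hω.exists_multiplier_le hα
  obtain ⟨C, hC, hd⟩ := hω.exists_abs_sub_multiplier_le hα
  obtain ⟨E, hE, he⟩ := exists_rpow_mul_pow_le (β := 2 * α) (by positivity)
  -- The first difference at index 0 is the coefficient `2 λ_1` itself, which needs its own
  -- constant.
  set C₁ := max C (2 * (B * 2 ^ α)) with hC₁
  have hC₁0 : 0 < C₁ := lt_max_of_lt_left hC
  have hd' : ∀ n, ‖firstDiff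
      (fun n => (fracKernelCoeff ω α n : ℂ)) n‖
      ≤ C₁ * ((n : ℝ) + 1) ^ α := by
    intro n
    cases n with
    | zero =>
      have h1 := hb 1
      have h2 := multiplier_nonneg hW hV 1
      simp only [firstDiff, fracKernelCoeff]
      rw [Complex.norm_real, Real.norm_of_nonneg (by positivity)]
      norm_num at h1 ⊢
      exact (mul_le_mul_of_nonneg_left h1 two_pos.le).trans (le_max_right _ _)
    | succ n =>
      simp only [firstDiff, fracKernelCoeff]
      rw [← Complex.ofReal_sub, Complex.norm_real, Real.norm_eq_abs]
      have h1 := hd (n + 1)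
      have h2 : |(((n + 1 : ℕ) : ℝ) + 2) * multiplier ω (powWeight ω α) (n + 1 + 1)
          - ((n : ℝ) + 2) * multiplier ω (powWeight ω α) (n + 1)|
          ≤ C * (((n + 1 : ℕ) : ℝ) + 1) ^ α := by
        convert h1 using 4
        push_cast
        ring
      refine h2.trans ?_
      gcongr
      exact le_max_left _ _
  obtain ⟨Q₀, hQ₀⟩ : ∃ Q₀, Q₀ = C₁ * Real.sqrt E := ⟨_, rfl⟩
  have hQ₀0 : 0 < Q₀ := by rw [hQ₀]; positivity
  refine ⟨2 * Q₀ * 2 ^ (α + 1) * α⁻¹, by positivity, fun z hz => ?_⟩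
  have hδ : 0 < 1 - ‖z‖ := by linarith
  obtain ⟨hint, hval⟩ := integral_rpow_neg_le hα hδ
  have := isFiniteMeasure_dA
  have hmain := integral_norm_tsum_le ha (W := fun _ => 1) (fun _ _ => zero_le_one)
    (integrable_const 1) hz
    (H := fun r => 2 * Q₀ * 2 ^ (α + 1) * (1 - r + (1 - ‖z‖)) ^ (-α - 1)) (hint.const_mul _)
    fun r hr => ?_
  · simp only [mul_one] at hmain
    refine hmain.trans ?_
    rw [intervalIntegral.integral_const_mul]
    calc _ ≤ 2 * Q₀ * 2 ^ (α + 1) * ((1 - ‖z‖) ^ (-α) / α) := by gcongr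
      _ = _ := by ring
  · have hz' : ‖conj z‖ = ‖z‖ := RCLike.norm_conj z
    have hr0 := hr.1
    have ht0 : 0 ≤ ‖z‖ * r := by positivity
    have ht1 : ‖z‖ * r < 1 := (mul_le_of_le_one_right (norm_nonneg z) hr.2.le).trans_lt hz
    obtain ⟨t, ht⟩ : ∃ t, t = ‖z‖ * r := ⟨_, rfl⟩
    rw [← ht] at ht0 ht1
    have h1t : 0 < 1 - t := by linarith
    -- The size of `Q` comes from `(n+1)^(2α) t^n ≤ E (1 - t)^(-2α)`; one further factor `t^n` is
    -- kept for the geometric sum.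
    have hQ : 0 < Q₀ * (1 - t) ^ (-α) := by positivity
    have h1 := circleAverage_norm_tsum_le
      (a := fun n => (fracKernelCoeff ω α n : ℂ))
      (z := conj z) hr0.le (by rwa [hz', ← ht]) (by rw [hz', ← ht]; exact ha _ ht0 ht1) hQ (fun n => by
        rw [hz', ← ht]
        have h2 := he n t ht0 ht1.le
        have e1 : (((n : ℝ) + 1) ^ α) ^ 2 = ((n : ℝ) + 1) ^ (2 * α) := by
          rw [← Real.rpow_natCast, ← Real.rpow_mul (by positivity), mul_comm α]
          norm_num
        have e2 : (1 - t) ^ (2 * α) * ((1 - t) ^ (-α)) ^ 2 = 1 := by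
          rw [← Real.rpow_natCast, ← Real.rpow_mul h1t.le, ← Real.rpow_add h1t]
          norm_num
          rw [show 2 * α + -(α * 2) = 0 by ring, Real.rpow_zero]
        calc _ ≤ (C₁ * ((n : ℝ) + 1) ^ α * t ^ n) ^ 2 := by
              gcongr
              exact hd' n
          _ = C₁ ^ 2 * ((((n : ℝ) + 1) ^ α) ^ 2 * (t ^ n * ((1 - t) ^ (2 * α)
              * ((1 - t) ^ (-α)) ^ 2))) * t ^ n := by
              rw [e2]
              ring
          _ = C₁ ^ 2 * (((n : ℝ) + 1) ^ (2 * α) * (t ^ n * (1 - t) ^ (2 * α)))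
              * ((1 - t) ^ (-α)) ^ 2 * t ^ n := by
              rw [e1]
              ring
          _ ≤ C₁ ^ 2 * E * ((1 - t) ^ (-α)) ^ 2 * t ^ n := by gcongr
          _ = _ := by
              rw [hQ₀, mul_pow, mul_pow, Real.sq_sqrt hE.le])
    rw [hz', ← ht] at h1
    have h2 : Q₀ * (1 - t) ^ (-α) / (1 - t)
        ≤ Q₀ * 2 ^ (α + 1) * (1 - r + (1 - ‖z‖)) ^ (-α - 1) := by
      have hr1 := hr.2
      have hz0 := norm_nonneg z
      have hx : 0 < 1 - r + (1 - ‖z‖) := by linarith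
      -- `1 - |z| r` is at least both `1 - r` and `1 - |z|`, hence at least their mean; a power of
      -- the mean is easily integrated in `r`.
      have h3 : (1 - r + (1 - ‖z‖)) / 2 ≤ 1 - t := by
        rw [ht]
        nlinarith
      have h4 : (1 - t) ^ (-α - 1) ≤ ((1 - r + (1 - ‖z‖)) / 2) ^ (-α - 1) :=
        Real.rpow_le_rpow_of_nonpos (by positivity) h3 (by linarith)
      have e3 : ((1 - r + (1 - ‖z‖)) / 2) ^ (-α - 1)
          = 2 ^ (α + 1) * (1 - r + (1 - ‖z‖)) ^ (-α - 1) := by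
        rw [div_eq_mul_inv, Real.mul_rpow hx.le (by norm_num), Real.inv_rpow (by norm_num),
          ← Real.rpow_neg (by norm_num), mul_comm]
        congr 2
        ring
      rw [e3] at h4
      rw [mul_div_assoc, ← Real.rpow_sub_one h1t.ne', mul_assoc]
      gcongr
    have h3 := h1.trans h2
    calc _ ≤ 2 * 1 * (1 * (Q₀ * 2 ^ (α + 1) * (1 - r + (1 - ‖z‖)) ^ (-α - 1))) := by
          have := hr.2.le
          gcongr
          rw [one_mul]
          exact Real.circleAverage_nonneg_of_nonneg fun ξ _ => norm_nonneg _
      _ = _ := by ring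

/-! ### The projection of bounded functions and its derivative. -/

theorem differentiableOn_deriv (f : Hol) :
    DifferentiableOn ℂ (deriv (extend f)) (Metric.ball 0 1) :=
  DifferentiableOn.deriv f.2 Metric.isOpen_ball

theorem hasSum_derivative (f : Hol) (z : Disk) :
    HasSum (fun n : ℕ => ((n : ℂ) + 1) * coeff f (n + 1) * (z : ℂ) ^ n) (derivative f z) := by
  have h := hasSum_taylorCoeff (differentiableOn_deriv f) (norm_coe_lt_one z)
  simp only [taylorCoeff_deriv] at h
  exact h

theorem continuous_derivative (f : Hol) : Continuous (derivative f) :=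
  continuousOn_iff_continuous_domRestrict.1 (differentiableOn_deriv f).continuousOn

theorem apply_origin (f : Hol) : f origin = coeff f 0 := by
  rw [← (hasSum_coeff f origin).tsum_eq, tsum_eq_single 0 fun n hn => ?_]
  · simp
  · simp [origin, hn]

theorem ae_norm_le (Φ : Lp ℂ ∞ dA) : ∀ᵐ ξ ∂dA, ‖Φ ξ‖ ≤ ‖Φ‖ := by
  have h := ae_le_eLpNormEssSup (f := Φ) (μ := dA)
  filter_upwards [h] with ξ hξ
  rw [Lp.norm_def, eLpNorm_exponent_top, ← toReal_enorm]
  refine ENNReal.toReal_mono ?_ hξ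
  rw [← eLpNorm_exponent_top]
  exact (Lp.memLp Φ).eLpNorm_ne_top

section Projection

variable {W : ℝ → ℝ}

theorem IsRadialWeight.integrable_Lp_mul (hW : IsRadialWeight W) (Φ : Lp ℂ ∞ dA) :
    Integrable (fun ξ : Disk => Φ ξ * (W ‖(ξ : ℂ)‖ : ℂ)) dA :=
  hW.integrable_mul_weight (Lp.aestronglyMeasurable Φ) (ae_norm_le Φ)

theorem IsRadialWeight.summableOnDisk_proj (hW : IsRadialWeight W) {φ : Disk → ℂ}
    (hφ : Integrable φ dA) :
    SummableOnDisk fun n => kernelCoeff W n * ∫ ξ : Disk, φ ξ * conj (ξ : ℂ) ^ n ∂dA := by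
  refine hW.summableOnDisk_kernelCoeff.of_norm_le (C := ∫ ξ : Disk, ‖φ ξ‖ ∂dA) fun n => ?_
  rw [norm_mul, mul_comm]
  gcongr
  exact (norm_integral_le_integral_norm _).trans (norm_integral_mul_conj_pow_le hφ n)

/-- The Bergman projection as a linear map from `L^∞` to the analytic functions. -/
noncomputable def projLinearMap (hW : IsRadialWeight W) : Lp ℂ ∞ dA →ₗ[ℂ] Hol where
  toFun Φ := ofSeries _ (hW.summableOnDisk_proj (hW.integrable_Lp_mul Φ))
  map_add' Φ Ψ := hol_ext_coeff fun n => by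
    rw [coeff_add, coeff_ofSeries, coeff_ofSeries, coeff_ofSeries, ← mul_add,
      ← integral_add (integrable_mul_conj_pow (hW.integrable_Lp_mul Φ) n)
        (integrable_mul_conj_pow (hW.integrable_Lp_mul Ψ) n)]
    congr 1
    refine integral_congr_ae ?_
    filter_upwards [Lp.coeFn_add Φ Ψ] with ξ hξ
    rw [hξ, Pi.add_apply]
    ring
  map_smul' c Φ := hol_ext_coeff fun n => by
    rw [RingHom.id_apply, coeff_smul, coeff_ofSeries, coeff_ofSeries, mul_left_comm,
      ← integral_const_mul c]
    congr 1
    refine integral_congr_ae ?_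
    filter_upwards [Lp.coeFn_smul c Φ] with ξ hξ
    rw [hξ, Pi.smul_apply, smul_eq_mul]
    ring

theorem coeff_projLinearMap (hW : IsRadialWeight W) (Φ : Lp ℂ ∞ dA) (n : ℕ) :
    coeff (projLinearMap hW Φ) n
      = kernelCoeff W n * ∫ ξ : Disk, Φ ξ * (W ‖(ξ : ℂ)‖ : ℂ) * conj (ξ : ℂ) ^ n ∂dA :=
  coeff_ofSeries (hW.summableOnDisk_proj (hW.integrable_Lp_mul Φ)) n

theorem integrable_projIntegrand (hW : IsRadialWeight W) (Φ : Lp ℂ ∞ dA) (z : Disk) :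
    Integrable (projIntegrand W Φ z) dA := by
  rw [hW.projIntegrand_eq]
  exact integrable_mul_tsum_mul_conj_pow (hW.integrable_Lp_mul Φ) hW.summableOnDisk_kernelCoeff
    (norm_coe_lt_one z)

theorem projLinearMap_apply (hW : IsRadialWeight W) (Φ : Lp ℂ ∞ dA) (z : Disk) :
    projLinearMap hW Φ z = bergmanProj W Φ z := by
  rw [bergmanProj, hW.projIntegrand_eq]
  exact (hasSum_integral_mul_tsum (hW.integrable_Lp_mul Φ) hW.summableOnDisk_kernelCoeff
    (norm_coe_lt_one z)).tsum_eq

/-- Differentiation shifts the index by one, which leaves a factor `conj ξ` of modulus less than 1.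
-/
theorem derivative_projLinearMap (hW : IsRadialWeight W) (Φ : Lp ℂ ∞ dA) (z : Disk) :
    derivative (projLinearMap hW Φ) z = ∫ ξ : Disk, Φ ξ * (W ‖(ξ : ℂ)‖ : ℂ) * conj (ξ : ℂ) ^ 1
      * ∑' n, (derivKernelCoeff W n : ℂ) * ((z : ℂ) * conj (ξ : ℂ)) ^ n ∂dA := by
  have h := hasSum_integral_mul_tsum (integrable_mul_conj_pow (hW.integrable_Lp_mul Φ) 1)
    hW.summableOnDisk_derivKernelCoeff (norm_coe_lt_one z)
  refine (hasSum_derivative _ z).unique ?_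
  simp only [coeff_projLinearMap]
  convert h using 2 with n
  simp only [mul_assoc, ← pow_add, add_comm 1 n, derivKernelCoeff]
  push_cast
  ring

theorem norm_derivative_projLinearMap_le (hW : IsRadialWeight W) (Φ : Lp ℂ ∞ dA) (z : Disk) :
    ‖derivative (projLinearMap hW Φ) z‖ ≤ ‖Φ‖ * ∫ ξ : Disk,
      ‖∑' n, (derivKernelCoeff W n : ℂ) * ((z : ℂ) * conj (ξ : ℂ)) ^ n‖ * W ‖(ξ : ℂ)‖ ∂dA := by
  rw [derivative_projLinearMap, ← integral_const_mul]
  refine norm_integral_le_of_norm_le (Integrable.const_mul ?_ _) ?_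
  · refine hW.integrable.bdd_mul
      (c := ∑' n, ‖(derivKernelCoeff W n : ℂ)‖ * ‖(z : ℂ)‖ ^ n)
      (continuous_tsum_mul_conj_pow hW.summableOnDisk_derivKernelCoeff
        (norm_coe_lt_one z)).norm.aestronglyMeasurable
      (Filter.Eventually.of_forall fun ξ => ?_)
    rw [norm_norm]
    exact norm_tsum_mul_conj_pow_le hW.summableOnDisk_derivKernelCoeff (norm_coe_lt_one z) ξ
  · filter_upwards [ae_norm_le Φ] with ξ hξ
    have hw := hW.weight_nonneg ξ
    have h1 := (norm_coe_lt_one ξ).le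
    rw [norm_mul, norm_mul, norm_mul, Complex.norm_real, Real.norm_of_nonneg hw, pow_one,
      RCLike.norm_conj]
    calc _ ≤ ‖Φ‖ * W ‖(ξ : ℂ)‖ * 1
          * ‖∑' n, (derivKernelCoeff W n : ℂ) * ((z : ℂ) * conj (ξ : ℂ)) ^ n‖ := by gcongr
      _ = _ := by ring

theorem norm_projLinearMap_origin_le (hW : IsRadialWeight W) (Φ : Lp ℂ ∞ dA) :
    ‖projLinearMap hW Φ origin‖
      ≤ kernelCoeff W 0 * (∫ ξ : Disk, W ‖(ξ : ℂ)‖ ∂dA) * ‖Φ‖ := by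
  rw [apply_origin, coeff_projLinearMap, norm_mul, Complex.norm_real,
    Real.norm_of_nonneg (hW.kernelCoeff_pos 0).le, mul_assoc]
  refine mul_le_mul_of_nonneg_left ?_ (hW.kernelCoeff_pos 0).le
  rw [← integral_mul_const]
  refine norm_integral_le_of_norm_le (hW.integrable.mul_const _) ?_
  filter_upwards [ae_norm_le Φ] with ξ hξ
  have hw := hW.weight_nonneg ξ
  rw [pow_zero, mul_one, norm_mul, Complex.norm_real, Real.norm_of_nonneg hw, mul_comm]
  gcongr

end Projection

/-- The Bergman projection maps `L^∞` boundedly into the Bloch space. -/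
theorem exists_blochNorm_projLinearMap_le (hω : IsDoublingWeight ω) :
    ∃ C : ℝ, ∀ Φ : Lp ℂ ∞ dA, MemBloch (projLinearMap hω.radialWeight Φ) ∧
      blochNorm (projLinearMap hω.radialWeight Φ) ≤ C * ‖Φ‖ := by
  have hW := hω.radialWeight
  obtain ⟨C, hC, h⟩ := hω.exists_integral_derivKernel_le
  have hb : ∀ (Φ : Lp ℂ ∞ dA) (z : Disk), (1 - ‖(z : ℂ)‖ ^ 2)
      * ‖derivative (projLinearMap hW Φ) z‖ ≤ 2 * C * ‖Φ‖ := by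
    intro Φ z
    have hz := norm_coe_lt_one z
    have hz0 := norm_nonneg (z : ℂ)
    have h1 : 0 < 1 - ‖(z : ℂ)‖ := by linarith
    have h2 := norm_derivative_projLinearMap_le hW Φ z
    have h3 := h2.trans (mul_le_mul_of_nonneg_left (h z hz) (norm_nonneg Φ))
    calc _ ≤ (2 * (1 - ‖(z : ℂ)‖)) * (‖Φ‖ * (C / (1 - ‖(z : ℂ)‖))) := by
          gcongr
          nlinarith
      _ = 2 * C * ‖Φ‖ := by field_simp
  refine ⟨2 * C + kernelCoeff ω 0 * (∫ ξ : Disk, ω ‖(ξ : ℂ)‖ ∂dA), fun Φ => ⟨?_, ?_⟩⟩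
  · exact ⟨2 * C * ‖Φ‖, by rintro _ ⟨z, rfl⟩; exact hb Φ z⟩
  · rw [blochNorm, add_mul]
    have : Nonempty Disk := ⟨origin⟩
    exact add_le_add (ciSup_le (hb Φ)) (norm_projLinearMap_origin_le hW Φ)

/-! ### The functions `g_α`: boundedness and reproduction of `h`. -/

theorem moment_one_sub_sq (n : ℕ) :
    moment (fun r => 1 - r ^ 2) (2 * n + 1) = (2 * ((n : ℝ) + 1) * (n + 2))⁻¹ := by
  have e : ∀ r : ℝ, r ^ (2 * n + 1) * (1 - r ^ 2) = r ^ (2 * n + 1) - r ^ (2 * n + 3) := by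
    intro r
    ring
  simp only [moment, e]
  rw [intervalIntegral.integral_sub (by simp) (by simp), integral_pow, integral_pow]
  have : (0 : ℝ) ≤ n := by positivity
  push_cast
  field_simp
  norm_num
  field_simp
  ring

/-- The fractional derivative of a function in terms of its derivative. -/
theorem fracDeriv_apply (hω : IsDoublingWeight ω) (hα : 0 < α) {h : Hol}
    (hi : Integrable (fun ξ : Disk => ((1 - ‖(ξ : ℂ)‖ ^ 2 : ℝ) : ℂ) * derivative h ξ) dA)
    (z : Disk) :
    fracDeriv ω (powWeight ω α) h z = multiplier ω (powWeight ω α) 0 * coeff h 0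
      + z * ∫ ξ : Disk, ((1 - ‖(ξ : ℂ)‖ ^ 2 : ℝ) : ℂ) * derivative h ξ
        * ∑' n, (fracKernelCoeff ω α n : ℂ) * ((z : ℂ) * conj (ξ : ℂ)) ^ n ∂dA := by
  have hW := hω.radialWeight
  have hV := hω.isRadialWeight_powWeight hα
  have h1 := hasSum_integral_mul_tsum hi (summableOnDisk_fracKernelCoeff hω hα)
    (norm_coe_lt_one z)
  -- Pairing `(1 - |ξ|²) h'` with `ξ^n` gives the coefficient of `h` at `n + 1` divided by `n + 2`;
  -- the factor `n + 2` in the kernel compensates for this.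
  have e : ∀ n, (fracKernelCoeff ω α n : ℂ) * ∫ ξ : Disk,
      ((1 - ‖(ξ : ℂ)‖ ^ 2 : ℝ) : ℂ) * derivative h ξ * conj (ξ : ℂ) ^ n ∂dA
      = coeff (fracDeriv ω (powWeight ω α) h) (n + 1) := by
    intro n
    have h2 := integrable_mul_conj_pow hi n
    have e1 : (fun ξ : Disk => ((1 - ‖(ξ : ℂ)‖ ^ 2 : ℝ) : ℂ) * derivative h ξ * conj (ξ : ℂ) ^ n)
        = fun ξ : Disk => deriv (extend h) ξ * conj (ξ : ℂ) ^ n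
          * (((fun r : ℝ => 1 - r ^ 2) ‖(ξ : ℂ)‖ : ℝ) : ℂ) := by
      ext ξ
      simp only [derivative]
      ring
    rw [e1] at h2 ⊢
    have h3 := integral_mul_conj_pow_mul (W := fun r : ℝ => 1 - r ^ 2) (differentiableOn_deriv h)
      n h2
    rw [h3, taylorCoeff_deriv, moment_one_sub_sq, coeff_fracDeriv hW hV, fracKernelCoeff]
    have hn1 : ((n : ℂ) + 1) ≠ 0 := by exact_mod_cast n.succ_ne_zero
    have hn2 : ((n : ℂ) + 2) ≠ 0 := by exact_mod_cast (n + 1).succ_ne_zero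
    push_cast
    change _ = _ * taylorCoeff (extend h) (n + 1)
    field_simp
  simp only [e] at h1
  have h2 := hasSum_coeff (fracDeriv ω (powWeight ω α) h) z
  have h3 := (h1.mul_left (z : ℂ))
  have h4 := (hasSum_nat_add_iff' 1).2 h2
  simp only [Finset.sum_range_one, pow_zero, mul_one] at h4
  have e3 : (fun n => coeff (fracDeriv ω (powWeight ω α) h) (n + 1) * (z : ℂ) ^ (n + 1))
      = fun n => (z : ℂ) * (coeff (fracDeriv ω (powWeight ω α) h) (n + 1) * (z : ℂ) ^ n) := by
    ext n
    ring
  rw [e3] at h4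
  have h5 := h4.unique h3
  rw [← h5, ← coeff_fracDeriv hW hV]
  ring

/-- In the integral representation `(1 - |ξ|²) h'` is bounded by the Bloch condition, and the kernel
contributes `(1 - |z|)^(-α)`, which the prefactor cancels. -/
theorem exists_norm_gFun_le (hω : IsDoublingWeight ω) (hα : 0 < α) {h : Hol} (hh : MemBloch h) :
    ∃ C : ℝ, ∀ z : Disk, ‖gFun ω α h z‖ ≤ C := by
  obtain ⟨M, hM⟩ := hh
  have hM : ∀ ξ : Disk, (1 - ‖(ξ : ℂ)‖ ^ 2) * ‖derivative h ξ‖ ≤ M := fun ξ => hM ⟨ξ, rfl⟩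
  have hM0 : 0 ≤ M := by
    refine le_trans ?_ (hM origin)
    simp [origin]
  obtain ⟨C, hC, hk⟩ := hω.exists_integral_fracKernel_le hα
  have := isFiniteMeasure_dA
  have hb : ∀ ξ : Disk, ‖((1 - ‖(ξ : ℂ)‖ ^ 2 : ℝ) : ℂ) * derivative h ξ‖ ≤ M := by
    intro ξ
    have hz := norm_coe_lt_one ξ
    have hz0 := norm_nonneg (ξ : ℂ)
    rw [norm_mul, Complex.norm_real, Real.norm_of_nonneg (by nlinarith)]
    exact hM ξ
  have hi : Integrable (fun ξ : Disk => ((1 - ‖(ξ : ℂ)‖ ^ 2 : ℝ) : ℂ) * derivative h ξ) dA := by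
    refine Integrable.of_bound (Continuous.aestronglyMeasurable ?_) M
      (Filter.Eventually.of_forall hb)
    have := continuous_derivative h
    fun_prop
  set B := ‖(multiplier ω (powWeight ω α) 0 * coeff h 0 : ℂ)‖ with hB
  refine ⟨B + M * C, fun z => ?_⟩
  have hz := norm_coe_lt_one z
  have hz0 := norm_nonneg (z : ℂ)
  have h1 : 0 < 1 - ‖(z : ℂ)‖ := by linarith
  have hsum := summableOnDisk_fracKernelCoeff hω hα
  have h2 : ‖∫ ξ : Disk, ((1 - ‖(ξ : ℂ)‖ ^ 2 : ℝ) : ℂ) * derivative h ξ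
        * ∑' n, (fracKernelCoeff ω α n : ℂ) * ((z : ℂ) * conj (ξ : ℂ)) ^ n ∂dA‖
      ≤ M * (C * (1 - ‖(z : ℂ)‖) ^ (-α)) := by
    refine le_trans ?_ (mul_le_mul_of_nonneg_left (hk z hz) hM0)
    rw [← integral_const_mul]
    refine norm_integral_le_of_norm_le (Integrable.const_mul ?_ _)
      (Filter.Eventually.of_forall fun ξ => ?_)
    · exact (Integrable.of_bound (continuous_tsum_mul_conj_pow hsum hz).aestronglyMeasurable _
        (Filter.Eventually.of_forall (norm_tsum_mul_conj_pow_le hsum hz))).norm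
    · rw [norm_mul]
      exact mul_le_mul_of_nonneg_right (hb ξ) (norm_nonneg _)
  have h3 : ‖fracDeriv ω (powWeight ω α) h z‖ ≤ B + M * (C * (1 - ‖(z : ℂ)‖) ^ (-α)) := by
    rw [fracDeriv_apply hω hα hi]
    refine (norm_add_le _ _).trans (add_le_add le_rfl ?_)
    rw [norm_mul]
    exact (mul_le_of_le_one_left (norm_nonneg _) hz.le).trans h2
  have hp : 0 < (1 - ‖(z : ℂ)‖) ^ α := Real.rpow_pos_of_pos h1 _
  rw [gFun, norm_mul, Complex.norm_real, Real.norm_of_nonneg hp.le]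
  calc (1 - ‖(z : ℂ)‖) ^ α * ‖fracDeriv ω (powWeight ω α) h z‖
      ≤ (1 - ‖(z : ℂ)‖) ^ α * (B + M * (C * (1 - ‖(z : ℂ)‖) ^ (-α))) := by gcongr
    _ = (1 - ‖(z : ℂ)‖) ^ α * B
        + M * C * ((1 - ‖(z : ℂ)‖) ^ α * (1 - ‖(z : ℂ)‖) ^ (-α)) := by ring
    _ = (1 - ‖(z : ℂ)‖) ^ α * B + M * C := by
        rw [← Real.rpow_add h1, add_neg_cancel, Real.rpow_zero, mul_one]
    _ ≤ B + M * C := by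
        gcongr
        exact mul_le_of_le_one_left (norm_nonneg _)
          (Real.rpow_le_one h1.le (by linarith) hα.le)

theorem continuous_gFun (hα : 0 < α) (h : Hol) : Continuous (gFun ω α h) := by
  have h1 : Continuous fun z : Disk => (1 - ‖(z : ℂ)‖) ^ α :=
    (continuous_one_sub_rpow hα.le).comp (continuous_norm.comp continuous_subtype_val)
  exact (Complex.continuous_ofReal.comp h1).mul (fracDeriv ω (powWeight ω α) h).1.continuous

theorem memLp_gFun (hω : IsDoublingWeight ω) (hα : 0 < α) {h : Hol} (hh : MemBloch h) :
    MemLp (gFun ω α h) ∞ dA := by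
  obtain ⟨C, hC⟩ := exists_norm_gFun_le hω hα hh
  exact memLp_top_of_bound (continuous_gFun hα h).aestronglyMeasurable C
    (Filter.Eventually.of_forall hC)

/-- `g_α ω` and `(R h) ω_α` agree pointwise. Pairing with `ξ^n` for the weight `ω_α` returns `λ_n`
times the coefficient of `h`, and `λ_n` is the ratio of the two kernel coefficients. -/
theorem bergmanProj_gFun (hω : IsDoublingWeight ω) (hα : 0 < α) {h : Hol} (hh : MemBloch h)
    (z : Disk) : bergmanProj ω (gFun ω α h) z = h z := by
  have hW := hω.radialWeight
  have hV := hω.isRadialWeight_powWeight hα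
  obtain ⟨C, hC⟩ := exists_norm_gFun_le hω hα hh
  have hi := hW.integrable_mul_weight (continuous_gFun (ω := ω) hα h).aestronglyMeasurable
    (Filter.Eventually.of_forall hC)
  have e : (fun ξ : Disk => gFun ω α h ξ * (ω ‖(ξ : ℂ)‖ : ℂ))
      = fun ξ : Disk => fracDeriv ω (powWeight ω α) h ξ * (powWeight ω α ‖(ξ : ℂ)‖ : ℂ) := by
    ext ξ
    rw [gFun, powWeight]
    push_cast
    ring
  have h1 := hasSum_integral_mul_tsum hi hW.summableOnDisk_kernelCoeff (norm_coe_lt_one z)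
  have e2 : ∀ n, (kernelCoeff ω n : ℂ)
      * ∫ ξ : Disk, gFun ω α h ξ * (ω ‖(ξ : ℂ)‖ : ℂ) * conj (ξ : ℂ) ^ n ∂dA = coeff h n := by
    intro n
    have hne : (multiplier ω (powWeight ω α) n : ℂ) ≠ 0 := by
      exact_mod_cast (div_pos (hW.moment_pos _) (hV.moment_pos _)).ne'
    refine mul_left_cancel₀ hne ?_
    rw [← mul_assoc, multiplier_mul_kernelCoeff hW, ← coeff_fracDeriv hW hV]
    have h2 := hV.integral_mul_conj_pow (e ▸ hi) n
    rw [← h2]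
    congr 2
    ext ξ
    rw [congrFun e ξ]
  simp only [e2] at h1
  rw [bergmanProj, hW.projIntegrand_eq]
  exact h1.unique (hasSum_coeff h z)

end BergmanBloch

theorem theorem4p1 (ω : ℝ → ℝ) (hω : IsDoublingWeight ω) :
    (∃ P : Lp ℂ ∞ dA →ₗ[ℂ] Hol,
      (∀ (Φ : Lp ℂ ∞ dA) (z : Disk),
        Integrable (projIntegrand ω Φ z) dA ∧ P Φ z = bergmanProj ω Φ z) ∧
      (∃ C : ℝ, ∀ Φ : Lp ℂ ∞ dA, MemBloch (P Φ) ∧ blochNorm (P Φ) ≤ C * ‖Φ‖) ∧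
      (∀ h : Hol, MemBloch h → ∃ Φ : Lp ℂ ∞ dA, P Φ = h)) ∧
    ∀ α : ℝ, 0 < α → ∀ h : Hol, MemBloch h →
      MemLp (gFun ω α h) ∞ dA ∧ ∀ z : Disk, bergmanProj ω (gFun ω α h) z = h z := by
  have hW := hω.radialWeight
  refine ⟨⟨projLinearMap hW, fun Φ z => ⟨integrable_projIntegrand hW Φ z,
    projLinearMap_apply hW Φ z⟩, exists_blochNorm_projLinearMap_le hω, fun h hh => ?_⟩,
    fun α hα h hh => ⟨memLp_gFun hω hα hh, bergmanProj_gFun hω hα hh⟩⟩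
  -- Any positive `α` yields a preimage; `α = 1` is used. The integral does not distinguish `g_1`
  -- from its class in `L^∞`.
  have hg := memLp_gFun hω one_pos hh
  refine ⟨hg.toLp _, hol_ext fun z => ?_⟩
  rw [projLinearMap_apply, ← bergmanProj_gFun hω one_pos hh z, bergmanProj, bergmanProj]
  refine integral_congr_ae ?_
  filter_upwards [hg.coeFn_toLp] with ξ hξ
  rw [projIntegrand, projIntegrand, hξ]
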